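/- Let $t\ge 1$ and $k\ge 3$ be integers and put $n=t(k-1)+2$. Let $\mathrm{GA}(t,k)$ be the generalized Andrásfai graph, that is, the Cayley graph of $(\mathbb Z/n,+)$ with respect to $\{1+jt \mid 0\le j\le k-1\}$ (vertex set $\mathbb Z/n$, edges $\{a,a+s\}$ with $a\in\mathbb Z/n$ and $s$ in the connection set), and let $\mathrm{GA}(t,k)'$ be the graph obtained from it by deleting the edges $\{a,a+1\}$, $a\in\mathbb Z/n$, of the exterior cycle. Let $\mathbb K$ be an arbitrary field, let $R$ be the standard graded polynomial ring over $\mathbb K$ whose variables $x_v$ are indexed by the vertices $v\in\mathbb Z/n$, and let $I=I(\mathrm{GA}(t,k)')\subseteq R$ be the edge ideal, generated by the products $x_ux_v$ with $\{u,v\}$ an edge of $\mathrm{GA}(t,k)'$. Then $I$ has a minimal graded free resolution $\cdots\to F_1\to F_0\to I\to 0$ by finitely generated graded free $R$-modules, and for every such resolution the graded Betti numbers $\beta_{i,j}$ (the number of generators of degree $j$ of $F_i$) satisfy, for all $i\ge 0$ and all $j\ge t+2$, $$\beta_{i,i+j}(I)=\begin{cases}1 & \text{if } i+j=n \text{ and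 } j=t+2,\\ 0 & \text{otherwise.}\end{cases}$$ In particular $\operatorname{reg} I=\max\{j\mid \beta_{i,i+j}(I)\ne 0 \text{ for some } i\}=t+2$. Moreover the regularity is attained only at the last step of the resolution, with a single $1$ there: the resolution has a finite length $p=\max\{i\mid F_i\neq 0\}$, one has $\beta_{p,p+t+2}(I)=1$, and $\beta_{i,i+t+2}(I)=0$ for all $i\ne p$. -/

import Mathlib

/-! ### Generalized Andrásfai graphs -/

/-- The generalized Andrásfai graph `GA(t,k)`: the Cayley graph of `ℤ/n`, `n = t(k-1)+2`, with
connection set `{1 + jt | 0 ≤ j ≤ k-1}`. -/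
def generalizedAndrasfai (t k : ℕ) : SimpleGraph (ZMod (t * (k - 1) + 2)) :=
  SimpleGraph.circulantGraph {s | ∃ j : ℕ, j < k ∧ s = ((1 + j * t : ℕ) : ZMod (t * (k - 1) + 2))}

/-- The exterior cycle of `GA(t,k)`, with edges `{i, i+1}` for `i ∈ ℤ/n`, `n = t(k-1)+2`. -/
def exteriorCycle (t k : ℕ) : SimpleGraph (ZMod (t * (k - 1) + 2)) :=
  SimpleGraph.circulantGraph {1}

/-- The graph `GA(t,k)'`: the graph `GA(t,k)` without the edges of the exterior cycle. -/
def generalizedAndrasfai' (t k : ℕ) : SimpleGraph (ZMod (t * (k - 1) + 2)) :=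
  generalizedAndrasfai t k \ exteriorCycle t k

/-! ### Edge ideals -/

/-- The edge ideal of a graph `G`, in the polynomial ring over `K` whose variables are the
vertices of `G`. -/
noncomputable def edgeIdeal (K : Type*) [Field K] {V : Type*} (G : SimpleGraph V) : Ideal (MvPolynomial V K) :=
  Ideal.span {f | ∃ u v : V, G.Adj u v ∧ f = MvPolynomial.X u * MvPolynomial.X v}

/-! ### Minimal graded free resolutions, Betti numbers, regularity, projective dimension -/

/-- The element `f` of the graded free module `⊕ₐ R(-dₐ)`, with `R` a (standard graded) polynomial
ring, is homogeneous of degree `m`: its `a`-th coordinate is homogeneous of degree `m - dₐ`, and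
is zero if `m < dₐ`. -/
def IsHomogeneousVector {K : Type*} [Field K] {V : Type*} {r : ℕ} (d : Fin r → ℕ)
    (f : Fin r → MvPolynomial V K) (m : ℕ) : Prop :=
  ∀ a, (d a ≤ m ∧ (f a).IsHomogeneous (m - d a)) ∨ f a = 0

/-- A minimal graded free resolution
`⋯ → F₂ → F₁ → F₀ → I → 0` of an ideal `I` of a polynomial ring `R` over a field (with its
standard grading), by finitely generated graded free modules `Fᵢ = ⊕ₐ R(-deg i a)`. -/
structure MinimalGradedFreeResolution {K : Type*} [Field K] {V : Type*}
    (I : Ideal (MvPolynomial V K)) where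
  /-- the rank of `Fᵢ` -/
  rank : ℕ → ℕ
  /-- the degrees of the basis elements of `Fᵢ` -/
  deg : (i : ℕ) → Fin (rank i) → ℕ
  /-- the augmentation `F₀ → I ⊆ R` -/
  aug : (Fin (rank 0) → MvPolynomial V K) →ₗ[MvPolynomial V K] MvPolynomial V K
  /-- the differential `Fᵢ₊₁ → Fᵢ` -/
  d : (i : ℕ) → (Fin (rank (i + 1)) → MvPolynomial V K) →ₗ[MvPolynomial V K]
    (Fin (rank i) → MvPolynomial V K)
  /-- the augmentation has degree `0` -/
  aug_homogeneous : ∀ f m, IsHomogeneousVector (deg 0) f m → (aug f).IsHomogeneous m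
  /-- the differentials have degree `0` -/
  d_homogeneous : ∀ i f m, IsHomogeneousVector (deg (i + 1)) f m →
    IsHomogeneousVector (deg i) (d i f) m
  /-- the image of the augmentation is `I` -/
  range_aug : LinearMap.range aug = I
  /-- exactness at `F₀` -/
  exact_zero : Function.Exact (d 0) aug
  /-- exactness at `Fᵢ₊₁` -/
  exact_succ : ∀ i, Function.Exact (d (i + 1)) (d i)
  /-- minimality: the image of `Fᵢ₊₁ → Fᵢ` lies in `𝔪 Fᵢ`, where `𝔪` is the ideal generated by
  the variables -/
  minimal : ∀ i f a, d i f a ∈ Ideal.span (Set.range (MvPolynomial.X (R := K) (σ := V)))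

namespace MinimalGradedFreeResolution

/-- The graded Betti number `β_{i,j}`: the number of generators of degree `j` in the `i`-th free
module of the minimal graded free resolution. -/
def betti {K : Type*} [Field K] {V : Type*} {I : Ideal (MvPolynomial V K)}
    (F : MinimalGradedFreeResolution I) (i j : ℕ) : ℕ :=
  (Finset.univ.filter fun a : Fin (F.rank i) => F.deg i a = j).card

/-- `r` is the Castelnuovo-Mumford regularity: the maximum of the `j` such that
`β_{i,i+j} ≠ 0` for some `i`. -/
def HasRegularity {K : Type*} [Field K] {V : Type*} {I : Ideal (MvPolynomial V K)}
    (F : MinimalGradedFreeResolution I) (r : ℕ) : Prop :=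
  IsGreatest {j : ℕ | ∃ i, F.betti i (i + j) ≠ 0} r

/-- `p` is the length of the resolution, i.e. its last step: the maximum of the `i` such that
`Fᵢ ≠ 0`. -/
def HasLength {K : Type*} [Field K] {V : Type*} {I : Ideal (MvPolynomial V K)}
    (F : MinimalGradedFreeResolution I) (p : ℕ) : Prop :=
  IsGreatest {i : ℕ | F.rank i ≠ 0} p

end MinimalGradedFreeResolution

/-! The proof is Hochster's formula combined with a computation of the cohomology of independence
complexes. For the edge ideal of a graph `G`, `β_{i,J}` is the sum, over vertex sets `W` with `J`
elements, of the dimensions of the reduced cohomology of the independence complex of `G[W]` at the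
faces with `J - i - 1` elements. Only two cases of this are needed: vanishing of all summands, and
the single summand in degree `J = n`.

Proper subsets. If `c ∉ W`, cut the cycle at `c` and number the vertices by their distance from `c`.
On positions at least 1, `u < w` are adjacent exactly when `w - u - 1` is a positive multiple of
`t`. Colour each edge by the residue of its left end mod `t`: a vertex to the left of `u` with the
same residue is adjacent to every right neighbour of `u`, so every colour is a Ferrers graph. With
`t` colours there is no cohomology at faces with more than `t` elements (`indepAcyclic_of_card_lt`,
`indepAcyclic_of_lt`), that is, for `j ≥ t + 2`.

The whole vertex set. Deleting one vertex leaves an acyclic complex, so cohomology is that of the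
link, shifted by one. In the link the same happens again and again, until two adjacent vertices
remain. Hence the full complex has the cohomology of a `t`-sphere, located at faces with `t + 1`
elements (`indepLine_univ`). This is the single 1 in degree `n`, at homological degree `n - t - 2`.

Length. For `c ∉ W`, the vertices of `W` at positions `1, …, t` form an independent set in which
every vertex has at most one neighbour. This kills the cohomology at small faces
(`indepAcyclic_of_lt_card`, `indepAcyclic_of_le`) and shows that the resolution stops at `n - t -
2`.

Algebra. Betti numbers are identified with Koszul cohomology of the ideal by dimension shifting
along the given resolution (`koszulRank_ker`, `koszulRank_range`). Koszul cohomology splits into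
multidegrees: non-squarefree strands are contractible, and the strand with support `W` is the
cochain complex of the simplex on `W` relative to the independence complex. Existence of a
resolution comes from iterating minimal homogeneous covers of syzygy modules. -/

/-! ### Weighted simplicial coboundaries -/

section Coboundary

variable {V : Type*} [DecidableEq V] {A : Type*} [CommRing A] {M : Type*} [AddCommGroup M]
  [Module A M]

/-- The weighted simplicial coboundary on functions on finite sets. -/
def coboundary (ε : Finset V → V → A) : (Finset V → M) →ₗ[A] (Finset V → M) where
  toFun f τ := ∑ v ∈ τ, ε (τ.erase v) v • f (τ.erase v)
  map_add' f g := by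
    funext τ
    simp [Finset.sum_add_distrib]
  map_smul' r f := by
    funext τ
    simp only [Pi.smul_apply, RingHom.id_apply, Finset.smul_sum]
    exact Finset.sum_congr rfl fun v _ => smul_comm _ _ _

theorem coboundary_apply (ε : Finset V → V → A) (f : Finset V → M) (τ : Finset V) :
    coboundary ε f τ = ∑ v ∈ τ, ε (τ.erase v) v • f (τ.erase v) := rfl

/-- Weights on the incidences of subsets of `W` for which the coboundary squares to zero. -/
def IsAlternatingOn (W : Finset V) (ε : Finset V → V → A) : Prop :=
  ∀ (τ : Finset V) (u v : V), τ ⊆ W → u ∈ W → v ∈ W → u ∉ τ → v ∉ τ → u ≠ v →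
    ε τ u * ε (insert u τ) v = -(ε τ v * ε (insert v τ) u)

theorem IsAlternatingOn.mono {W W' : Finset V} {ε : Finset V → V → A}
    (h : IsAlternatingOn W ε) (hW : W' ⊆ W) : IsAlternatingOn W' ε :=
  fun τ u v hτ hu hv => h τ u v (hτ.trans hW) (hW hu) (hW hv)

/-- The link of `v` inherits the weights `τ ↦ ε (insert v τ)`. Acyclicity is stated for all nowhere
vanishing alternating weights so that inductions can pass to links without comparing signs. -/
theorem IsAlternatingOn.insert {W : Finset V} {ε : Finset V → V → A} {v : V}
    (h : IsAlternatingOn W ε) (hv : v ∈ W) :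
    IsAlternatingOn (W.erase v) (fun τ => ε (insert v τ)) := by
  intro τ x y hτ hx hy hxτ hyτ hxy
  rw [Finset.mem_erase] at hx hy
  have := h (Insert.insert v τ) x y
    (Finset.insert_subset hv (hτ.trans (Finset.erase_subset _ _))) hx.2 hy.2
    (by simp [hx.1, hxτ]) (by simp [hy.1, hyτ]) hxy
  rwa [Finset.insert_comm x, Finset.insert_comm y] at this

theorem coboundary_insert (ε : Finset V → V → A) (f : Finset V → M) {τ : Finset V} {v : V}
    (hv : v ∉ τ) : coboundary ε f (insert v τ) =
      ε τ v • f τ + coboundary (fun τ => ε (insert v τ)) (fun τ => f (insert v τ)) τ := by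
  rw [coboundary_apply, Finset.sum_insert hv, Finset.erase_insert hv, coboundary_apply]
  congr 1
  refine Finset.sum_congr rfl fun u hu => ?_
  have : u ≠ v := fun h => hv (h ▸ hu)
  rw [Finset.erase_insert_of_ne this.symm]

theorem coboundary_congr {ε : Finset V → V → A} {f g : Finset V → M} {τ : Finset V}
    (h : ∀ v ∈ τ, f (τ.erase v) = g (τ.erase v)) : coboundary ε f τ = coboundary ε g τ :=
  Finset.sum_congr rfl fun v hv => by rw [h v hv]

theorem coboundary_eq_zero {ε : Finset V → V → A} {f : Finset V → M} {τ : Finset V}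
    (h : ∀ v ∈ τ, f (τ.erase v) = 0) : coboundary ε f τ = 0 :=
  Finset.sum_eq_zero fun v hv => by rw [h v hv, smul_zero]

/-- Splitting off `v` from the set, the terms that remove `v` and some `u` in the two possible
orders cancel by the alternating relation; what remains is the square of the coboundary for the link
weights, which vanishes by induction. -/
theorem coboundary_coboundary {W : Finset V} {ε : Finset V → V → A} (hε : IsAlternatingOn W ε)
    (f : Finset V → M) {τ : Finset V} (hτ : τ ⊆ W) : coboundary ε (coboundary ε f) τ = 0 := by
  induction τ using Finset.induction_on generalizing W ε f with
  | empty => simp [coboundary_apply]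
  | insert v τ hv ih =>
    have hvW : v ∈ W := hτ (Finset.mem_insert_self _ _)
    have hτW : τ ⊆ W := (Finset.subset_insert _ _).trans hτ
    have hτe : τ ⊆ W.erase v := fun x hx => Finset.mem_erase.2 ⟨fun h => hv (h ▸ hx), hτW hx⟩
    rw [coboundary_insert _ _ hv]
    have h1 : coboundary (fun τ => ε (insert v τ)) (fun τ => coboundary ε f (insert v τ)) τ =
        coboundary (fun τ => ε (insert v τ)) ((fun τ => ε τ v • f τ) +
          coboundary (fun τ => ε (insert v τ)) (fun τ => f (insert v τ))) τ := by
      refine coboundary_congr fun u hu => ?_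
      rw [coboundary_insert _ _ (fun h => hv (Finset.mem_of_mem_erase h))]
      rfl
    rw [h1, map_add, Pi.add_apply, ih (hε.insert hvW) _ hτe, add_zero, coboundary_apply,
      coboundary_apply, Finset.smul_sum, ← Finset.sum_add_distrib]
    refine Finset.sum_eq_zero fun u hu => ?_
    have huv : u ≠ v := fun h => hv (h ▸ hu)
    have := hε (τ.erase u) u v ((Finset.erase_subset _ _).trans hτW) (hτW hu) hvW
      (Finset.notMem_erase _ _) (fun h => hv (Finset.mem_of_mem_erase h)) huv
    rw [Finset.insert_erase hu] at this
    rw [smul_smul, smul_smul, ← add_smul, mul_comm (ε τ v), this, mul_comm (ε (τ.erase u) v)]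
    simp

theorem coboundary_comp_linearMap {N : Type*} [AddCommGroup N] [Module A N]
    (ε : Finset V → V → A) (φ : M →ₗ[A] N) (f : Finset V → M) (τ : Finset V) :
    coboundary ε (fun σ => φ (f σ)) τ = φ (coboundary ε f τ) := by
  simp [coboundary_apply]

end Coboundary

/-! ### Contraction of cones -/

section Cone

variable {V : Type*} [DecidableEq V] {K : Type*} [Field K]

/-- The contraction of the cochains of a cone with apex `v`. -/
def contractCone (ε : Finset V → V → K) (v : V) (f : Finset V → K) (τ : Finset V) : K :=
  if v ∈ τ then 0 else (ε τ v)⁻¹ * f (insert v τ)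

/-- If `v ∈ τ`, only the term removing `v` survives and returns `f τ`. If `v ∉ τ`, the cocycle
condition at `insert v τ` expresses `f τ` through the values on faces containing `v`. Asking for
that condition at this one set only lets the lemma serve complexes that are not closed under all
insertions. -/
theorem coboundary_contractCone {W : Finset V} {ε : Finset V → V → K}
    (hε : IsAlternatingOn W ε) (h0 : ∀ τ v, ε τ v ≠ 0) {v : V} (hv : v ∈ W) (f : Finset V → K)
    {τ : Finset V} (hτ : τ ⊆ W) (hf : v ∉ τ → coboundary ε f (insert v τ) = 0) :
    coboundary ε (contractCone ε v f) τ = f τ := by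
  by_cases hvτ : v ∈ τ
  · rw [coboundary_apply, Finset.sum_eq_single_of_mem v hvτ]
    · rw [contractCone, if_neg (Finset.notMem_erase _ _), Finset.insert_erase hvτ, smul_eq_mul,
        mul_inv_cancel_left₀ (h0 _ _)]
    · intro u hu huv
      rw [contractCone, if_pos (Finset.mem_erase.2 ⟨huv.symm, hvτ⟩), smul_zero]
  · have h1 := hf hvτ
    rw [coboundary_insert _ _ hvτ, smul_eq_mul, add_eq_zero_iff_eq_neg] at h1
    rw [← mul_right_inj' (h0 τ v), h1, coboundary_apply, coboundary_apply, Finset.mul_sum,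
      ← Finset.sum_neg_distrib]
    refine Finset.sum_congr rfl fun u hu => ?_
    have huv : u ≠ v := fun h => hvτ (h ▸ hu)
    have hve : v ∉ τ.erase u := fun h => hvτ (Finset.mem_of_mem_erase h)
    have := hε (τ.erase u) u v ((Finset.erase_subset _ _).trans hτ) (hτ hu) hv
      (Finset.notMem_erase _ _) hve huv
    rw [Finset.insert_erase hu] at this
    rw [contractCone, if_neg hve, smul_eq_mul, smul_eq_mul, ← mul_assoc, mul_comm (ε τ v), this]
    field_simp [h0 (τ.erase u) v]

end Cone

/-! ### Independence complexes, deletions and links -/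

section IndependenceComplex

variable {V : Type*} [DecidableEq V] (K : Type*) [Field K] (G : SimpleGraph V)

/-- `f` is a cocycle on the independent subsets of `W` with `s` elements. -/
def IsIndepCocycle (W : Finset V) (s : ℤ) (ε : Finset V → V → K) (f : Finset V → K) : Prop :=
  ∀ τ ⊆ W, G.IsIndepSet (τ : Set V) → (τ.card : ℤ) = s + 1 → coboundary ε f τ = 0

/-- The cohomology with coefficients in `K` of the independence complex of the subgraph of `G`
induced on `W` vanishes at the faces with `s` elements. -/
def IndepAcyclic (W : Finset V) (s : ℤ) : Prop :=
  ∀ ε : Finset V → V → K, IsAlternatingOn W ε → (∀ τ v, ε τ v ≠ 0) →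
    ∀ f : Finset V → K, IsIndepCocycle K G W s ε f →
      ∃ g : Finset V → K, ∀ τ ⊆ W, G.IsIndepSet (τ : Set V) → (τ.card : ℤ) = s →
        f τ = coboundary ε g τ

/-- The cohomology with coefficients in `K` of the independence complex of the subgraph of `G`
induced on `W` is one-dimensional at the faces with `s` elements. -/
def IndepLine (W : Finset V) (s : ℤ) : Prop :=
  ∀ ε : Finset V → V → K, IsAlternatingOn W ε → (∀ τ v, ε τ v ≠ 0) →
    ∃ ω : Finset V → K, IsIndepCocycle K G W s ε ω ∧
      (¬ ∃ g : Finset V → K, ∀ τ ⊆ W, G.IsIndepSet (τ : Set V) → (τ.card : ℤ) = s →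
        ω τ = coboundary ε g τ) ∧
      ∀ f : Finset V → K, IsIndepCocycle K G W s ε f →
        ∃ (r : K) (g : Finset V → K), ∀ τ ⊆ W, G.IsIndepSet (τ : Set V) → (τ.card : ℤ) = s →
          f τ = r * ω τ + coboundary ε g τ

open Classical in
/-- The vertices of `W` outside of the closed neighbourhood of `v`. -/
noncomputable def awayFrom (W : Finset V) (v : V) : Finset V :=
  W.filter fun w => w ≠ v ∧ ¬ G.Adj v w

variable {K G}

theorem mem_awayFrom {W : Finset V} {v w : V} :
    w ∈ awayFrom G W v ↔ w ∈ W ∧ w ≠ v ∧ ¬ G.Adj v w := by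
  simp [awayFrom]

omit [DecidableEq V] in
theorem isIndepSet_mono {τ σ : Finset V} (h : G.IsIndepSet (τ : Set V)) (hσ : σ ⊆ τ) :
    G.IsIndepSet (σ : Set V) := Set.Pairwise.mono (by exact_mod_cast hσ) h

theorem isIndepSet_insert {τ W : Finset V} {v : V} (hτ : τ ⊆ awayFrom G W v)
    (h : G.IsIndepSet (τ : Set V)) : G.IsIndepSet ((insert v τ : Finset V) : Set V) := by
  have hN : ∀ x ∈ τ, ¬ G.Adj v x := fun x hx => (mem_awayFrom.1 (hτ hx)).2.2
  intro x hx y hy hxy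
  rw [Finset.mem_coe, Finset.mem_insert] at hx hy
  rcases hx with rfl | hx
  · exact hN y (hy.resolve_left hxy.symm)
  · rcases hy with rfl | hy
    · exact fun h => hN x hx h.symm
    · exact h hx hy hxy

theorem subset_awayFrom {τ W : Finset V} {v : V} (hv : v ∉ τ) (hτ : τ ⊆ W)
    (h : G.IsIndepSet ((insert v τ : Finset V) : Set V)) : τ ⊆ awayFrom G W v := by
  intro x hx
  have hxv : x ≠ v := fun h => hv (h ▸ hx)
  exact mem_awayFrom.2 ⟨hτ hx, hxv, h (by simp) (by simp [hx]) hxv.symm⟩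

theorem notMem_of_subset_awayFrom {τ W : Finset V} {v : V} (hτ : τ ⊆ awayFrom G W v) : v ∉ τ :=
  fun h => (mem_awayFrom.1 (hτ h)).2.1 rfl

theorem awayFrom_subset (W : Finset V) (v : V) : awayFrom G W v ⊆ W.erase v :=
  fun _ hx => Finset.mem_erase.2 ⟨(mem_awayFrom.1 hx).2.1, (mem_awayFrom.1 hx).1⟩

/-- An isolated vertex can be added to every independent set, so the complex is a cone with apex
`v`. -/
theorem indepAcyclic_of_isolated {W : Finset V} {v : V} (hv : v ∈ W)
    (h : ∀ w ∈ W, ¬ G.Adj v w) (s : ℤ) : IndepAcyclic K G W s := by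
  intro ε hε h0 f hf
  refine ⟨contractCone ε v f, fun τ hτ hi hc => ?_⟩
  refine (coboundary_contractCone hε h0 hv f hτ fun hvτ => ?_).symm
  refine hf _ (Finset.insert_subset hv hτ) ?_ (by rw [Finset.card_insert_of_notMem hvτ]; simp [hc])
  refine isIndepSet_insert (W := W) (fun x hx => ?_) hi
  exact mem_awayFrom.2 ⟨hτ hx, fun h => hvτ (h ▸ hx), h x (hτ hx)⟩

theorem indepAcyclic_of_neg (W : Finset V) {s : ℤ} (hs : s < 0) : IndepAcyclic K G W s :=
  fun _ _ _ _ _ => ⟨0, fun τ _ _ hc => absurd hc (by omega)⟩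

theorem indepAcyclic_empty {s : ℤ} (hs : s ≠ 0) : IndepAcyclic K G (∅ : Finset V) s := by
  refine fun _ _ _ _ _ => ⟨0, fun τ hτ _ hc => absurd hc ?_⟩
  rw [Finset.subset_empty.1 hτ]
  simpa using hs.symm

theorem IsIndepCocycle.sub_coboundary {W : Finset V} {s : ℤ} {ε : Finset V → V → K}
    (hε : IsAlternatingOn W ε) {f : Finset V → K} (hf : IsIndepCocycle K G W s ε f)
    (g : Finset V → K) : IsIndepCocycle K G W s ε (f - coboundary ε g) := by
  intro τ hτ hi hc
  rw [map_sub, Pi.sub_apply, hf τ hτ hi hc, coboundary_coboundary hε g hτ, sub_zero]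

/-- A cocycle can be changed by a coboundary so that it vanishes on the faces without `v`. -/
theorem exists_sub_coboundary_eq_zero {W : Finset V} {v : V} {s : ℤ}
    (hdel : IndepAcyclic K G (W.erase v) s) {ε : Finset V → V → K}
    (hε : IsAlternatingOn W ε) (h0 : ∀ τ v, ε τ v ≠ 0) {f : Finset V → K}
    (hf : IsIndepCocycle K G W s ε f) :
    ∃ g : Finset V → K, ∀ τ ⊆ W, G.IsIndepSet (τ : Set V) → (τ.card : ℤ) = s → v ∉ τ →
      (f - coboundary ε g) τ = 0 := by
  obtain ⟨g, hg⟩ := hdel ε (hε.mono (Finset.erase_subset _ _)) h0 f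
    (fun τ hτ hi hc => hf τ (hτ.trans (Finset.erase_subset _ _)) hi hc)
  refine ⟨g, fun τ hτ hi hc hv => ?_⟩
  rw [Pi.sub_apply, hg τ (Finset.subset_erase.2 ⟨hτ, hv⟩) hi hc, sub_self]

/-- A cocycle vanishing on the faces without `v` restricts to a cocycle of the link of `v`. -/
theorem IsIndepCocycle.link {W : Finset V} {v : V} (hv : v ∈ W) {s : ℤ} {ε : Finset V → V → K}
    {f : Finset V → K} (hf : IsIndepCocycle K G W s ε f)
    (hz : ∀ τ ⊆ W, G.IsIndepSet (τ : Set V) → (τ.card : ℤ) = s → v ∉ τ → f τ = 0) :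
    IsIndepCocycle K G (awayFrom G W v) (s - 1) (fun τ => ε (insert v τ))
      (fun τ => f (insert v τ)) := by
  intro τ hτ hi hc
  have hvτ := notMem_of_subset_awayFrom hτ
  have hτW : τ ⊆ W := (hτ.trans (awayFrom_subset W v)).trans (Finset.erase_subset _ _)
  have h1 := hf (insert v τ) (Finset.insert_subset hv hτW) (isIndepSet_insert hτ hi)
    (by rw [Finset.card_insert_of_notMem hvτ]; push_cast; omega)
  rw [coboundary_insert _ _ hvτ, hz τ hτW hi (by omega) hvτ, smul_zero, zero_add] at h1
  exact h1

/-- Extension of a cochain of the link of `v`. -/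
def extendLink (v : V) (g : Finset V → K) (τ : Finset V) : K := if v ∈ τ then g (τ.erase v) else 0

theorem coboundary_extendLink_of_notMem (ε : Finset V → V → K) {v : V} (g : Finset V → K)
    {τ : Finset V} (hv : v ∉ τ) : coboundary ε (extendLink v g) τ = 0 :=
  coboundary_eq_zero fun _ _ => if_neg fun h => hv (Finset.mem_of_mem_erase h)

theorem coboundary_extendLink_insert (ε : Finset V → V → K) {v : V} (g : Finset V → K)
    {τ : Finset V} (hv : v ∉ τ) : coboundary ε (extendLink v g) (insert v τ) =
      coboundary (fun τ => ε (insert v τ)) g τ := by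
  rw [coboundary_insert _ _ hv, extendLink, if_neg hv, smul_zero, zero_add]
  refine coboundary_congr fun u hu => ?_
  rw [extendLink, if_pos (Finset.mem_insert_self _ _),
    Finset.erase_insert fun h => hv (Finset.mem_of_mem_erase h)]

theorem exists_eq_insert {τ W : Finset V} {v : V} (hv : v ∈ τ) (hτ : τ ⊆ W)
    (hi : G.IsIndepSet (τ : Set V)) : ∃ σ, τ = insert v σ ∧ σ ⊆ awayFrom G W v ∧ v ∉ σ ∧
      G.IsIndepSet (σ : Set V) ∧ τ.card = σ.card + 1 :=
  ⟨τ.erase v, (Finset.insert_erase hv).symm, subset_awayFrom (Finset.notMem_erase _ _)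
    ((Finset.erase_subset _ _).trans hτ) (by rwa [Finset.insert_erase hv]),
    Finset.notMem_erase _ _, isIndepSet_mono hi (Finset.erase_subset _ _),
    (Finset.card_erase_add_one hv).symm⟩

/-- This is the exact sequence of deletion and link, done by hand: correct the cocycle to vanish off
`v`, then bound its restriction to the link, whose faces are one element smaller. -/
theorem IndepAcyclic.of_erase_of_awayFrom {W : Finset V} {v : V} (hv : v ∈ W) {s : ℤ}
    (hdel : IndepAcyclic K G (W.erase v) s)
    (hlink : IndepAcyclic K G (awayFrom G W v) (s - 1)) : IndepAcyclic K G W s := by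
  intro ε hε h0 f hf
  obtain ⟨g, hg⟩ := exists_sub_coboundary_eq_zero hdel hε h0 hf
  obtain ⟨g', hg'⟩ := hlink _ ((hε.insert hv).mono (awayFrom_subset W v)) (fun _ _ => h0 _ _) _
    ((hf.sub_coboundary hε g).link hv hg)
  refine ⟨g + extendLink v g', fun τ hτ hi hc => ?_⟩
  rw [map_add, Pi.add_apply]
  by_cases hvτ : v ∈ τ
  · obtain ⟨σ, rfl, hσ, hvσ, hσi, hcard⟩ := exists_eq_insert hvτ hτ hi
    rw [coboundary_extendLink_insert _ _ hvσ, ← hg' σ hσ hσi (by omega)]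
    simp
  · rw [coboundary_extendLink_of_notMem _ _ hvτ, add_zero]
    exact sub_eq_zero.1 (hg τ hτ hi hc hvτ)

/-- With an acyclic deletion the connecting map from the link is an isomorphism. Injectivity uses
acyclicity of the deletion at `s - 1`, surjectivity at `s`. -/
theorem IndepLine.of_erase_of_awayFrom {W : Finset V} {v : V} (hv : v ∈ W) {s : ℤ}
    (hdel : ∀ r, IndepAcyclic K G (W.erase v) r)
    (hlink : IndepLine K G (awayFrom G W v) (s - 1)) : IndepLine K G W s := by
  intro ε hε h0
  obtain ⟨ω, hω, hne, hspan⟩ := hlink _ ((hε.insert hv).mono (awayFrom_subset W v))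
    (fun _ _ => h0 _ _)
  refine ⟨extendLink v ω, ?_, ?_, ?_⟩
  · intro τ hτ hi hc
    by_cases hvτ : v ∈ τ
    · obtain ⟨σ, rfl, hσ, hvσ, hσi, hcard⟩ := exists_eq_insert hvτ hτ hi
      rw [coboundary_extendLink_insert _ _ hvσ]
      exact hω σ hσ hσi (by omega)
    · exact coboundary_extendLink_of_notMem _ _ hvτ
  · rintro ⟨g, hg⟩
    -- Since `extendLink v ω` vanishes off `v`, its primitive `g` is a cocycle on the deletion one
    -- step lower. Subtracting a coboundary makes `g` vanish off `v`, after which it restricts to a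
    -- primitive of `ω` on the link.
    obtain ⟨h, hh⟩ := hdel (s - 1) ε (hε.mono (Finset.erase_subset _ _)) h0 g (by
      intro τ hτ hi hc
      have hvτ : v ∉ τ := fun h => Finset.notMem_erase _ _ (hτ h)
      rw [← hg τ (hτ.trans (Finset.erase_subset _ _)) hi (by omega), extendLink, if_neg hvτ])
    refine hne ⟨fun τ => (g - coboundary ε h) (insert v τ), fun τ hτ hi hc => ?_⟩
    have hvτ := notMem_of_subset_awayFrom hτ
    have hτe : τ ⊆ W.erase v := hτ.trans (awayFrom_subset W v)
    have hτW : insert v τ ⊆ W := Finset.insert_subset hv (hτe.trans (Finset.erase_subset _ _))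
    have h1 := hg (insert v τ) hτW (isIndepSet_insert hτ hi)
      (by rw [Finset.card_insert_of_notMem hvτ]; push_cast; omega)
    have h2 : coboundary ε (g - coboundary ε h) (insert v τ) = coboundary ε g (insert v τ) := by
      rw [map_sub, Pi.sub_apply, coboundary_coboundary hε _ hτW, sub_zero]
    rw [extendLink, if_pos (Finset.mem_insert_self _ _), Finset.erase_insert hvτ, ← h2,
      coboundary_insert _ _ hvτ, Pi.sub_apply, hh τ hτe hi hc, sub_self, smul_zero, zero_add] at h1
    exact h1
  · intro f hf
    obtain ⟨g, hg⟩ := exists_sub_coboundary_eq_zero (hdel s) hε h0 hf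
    obtain ⟨r, g', hg'⟩ := hspan _ ((hf.sub_coboundary hε g).link hv hg)
    refine ⟨r, g + extendLink v g', fun τ hτ hi hc => ?_⟩
    rw [map_add, Pi.add_apply]
    by_cases hvτ : v ∈ τ
    · obtain ⟨σ, rfl, hσ, hvσ, hσi, hcard⟩ := exists_eq_insert hvτ hτ hi
      have h1 := hg' σ hσ hσi (by omega)
      rw [coboundary_extendLink_insert _ _ hvσ, extendLink,
        if_pos (Finset.mem_insert_self _ _), Finset.erase_insert hvσ]
      rw [Pi.sub_apply, sub_eq_iff_eq_add] at h1
      rw [h1]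
      ring
    · rw [coboundary_extendLink_of_notMem _ _ hvτ, extendLink, if_neg hvτ]
      have := sub_eq_zero.1 (hg τ hτ hi hc hvτ)
      simpa using this

/-- The empty set counts as a face, so the complex on no vertices carries one class, at `s = 0`.
This is where the sphere inductions end. -/
theorem indepLine_empty : IndepLine K G (∅ : Finset V) 0 := by
  intro ε _ _
  refine ⟨fun _ => 1, fun τ hτ _ hc => ?_, ?_, fun f _ => ⟨f ∅, 0, fun τ hτ _ _ => ?_⟩⟩
  · rw [Finset.subset_empty.1 hτ] at hc
    simp at hc
  · rintro ⟨g, hg⟩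
    simpa [coboundary_apply] using hg ∅ subset_rfl (by simp) (by simp)
  · rw [Finset.subset_empty.1 hτ]
    simp

end IndependenceComplex

/-! ### Two vanishing criteria for independence complexes -/

section Criteria

variable {V : Type*} [DecidableEq V] {K : Type*} [Field K] {G : SimpleGraph V}

/-- If every vertex of `W` has at most one neighbour in the independent set `S ⊆ W`, then the
independence complex on `W` has no cohomology below the dimension of the simplex `S`. -/
theorem indepAcyclic_of_lt_card {W S : Finset V} (hSW : S ⊆ W) (hS : G.IsIndepSet (S : Set V))
    (hdom : ∀ v ∈ W, ∀ x ∈ S, ∀ y ∈ S, G.Adj v x → G.Adj v y → x = y) {s : ℤ}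
    (hs : s < S.card) : IndepAcyclic K G W s := by
  induction h : W.card using Nat.strong_induction_on generalizing W S s with
  | _ m ih =>
    rcases lt_or_ge s 0 with h0 | h0
    · exact indepAcyclic_of_neg W h0
    obtain ⟨x, hx⟩ : S.Nonempty := Finset.card_pos.1 (by omega)
    by_cases hiso : ∀ w ∈ W, ¬ G.Adj x w
    · exact indepAcyclic_of_isolated (hSW hx) hiso s
    · push Not at hiso
      -- For a neighbour `v` of `x`, the deletion of `v` keeps all of `S`, while the link of `v`
      -- loses only `x`, because `v` has no other neighbour in `S`. Both bounds are preserved.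
      obtain ⟨v, hv, hxv⟩ := hiso
      have hvS : v ∉ S := fun hvS => hS hx hvS hxv.ne hxv
      have hlt : (W.erase v).card < m := h ▸ Finset.card_erase_lt_of_mem hv
      refine IndepAcyclic.of_erase_of_awayFrom hv
        (ih _ hlt (Finset.subset_erase.2 ⟨hSW, hvS⟩) hS
          (fun u hu => hdom u (Finset.mem_of_mem_erase hu)) hs rfl)
        (ih _ ((Finset.card_le_card (awayFrom_subset W v)).trans_lt hlt) (S := S.erase x) ?_
          (isIndepSet_mono hS (Finset.erase_subset _ _)) ?_ ?_ rfl)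
      · intro y hy
        rw [Finset.mem_erase] at hy
        exact mem_awayFrom.2 ⟨hSW hy.2, fun h => hvS (h ▸ hy.2),
          fun h => hy.1 (hdom v hv y hy.2 x hx h hxv.symm)⟩
      · exact fun u hu y hy z hz => hdom u (mem_awayFrom.1 hu).1 y (Finset.mem_of_mem_erase hy) z
          (Finset.mem_of_mem_erase hz)
      · rw [Finset.card_erase_of_mem hx]
        have := Finset.card_pos.2 ⟨x, hx⟩
        omega

/-- If the edges of the graph on `W`, oriented along `pos`, are coloured in such a way that the
edges of each colour form a Ferrers graph, then the independence complex on `W` has no cohomology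
above the number of colours. -/
theorem indepAcyclic_of_card_lt {W : Finset V} {pos col : V → ℕ} {C : Finset ℕ}
    (hpos : ∀ u ∈ W, ∀ w ∈ W, G.Adj u w → pos u ≠ pos w)
    (hcol : ∀ u ∈ W, ∀ w ∈ W, G.Adj u w → pos u < pos w → col u ∈ C)
    (hnest : ∀ v ∈ W, ∀ u ∈ W, ∀ w ∈ W, G.Adj u w → pos u < pos w → pos v ≤ pos u →
      col v = col u → G.Adj v w) {s : ℤ} (hs : C.card < s) : IndepAcyclic K G W s := by
  induction h : W.card + C.card using Nat.strong_induction_on generalizing W C s with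
  | _ m ih =>
    rcases W.eq_empty_or_nonempty with rfl | ⟨x, hx⟩
    · exact indepAcyclic_empty (by omega)
    rcases C.eq_empty_or_nonempty with rfl | ⟨r, hr⟩
    · refine indepAcyclic_of_isolated hx (fun w hw hxw => ?_) s
      rcases (hpos x hx w hw hxw).lt_or_gt with h1 | h1
      · exact absurd (hcol x hx w hw hxw h1) (Finset.notMem_empty _)
      · exact absurd (hcol w hw x hx hxw.symm h1) (Finset.notMem_empty _)
    have hCr := Finset.card_erase_add_one hr
    classical
    rcases (W.filter fun u => col u = r ∧ ∃ w ∈ W, G.Adj u w ∧ pos u < pos w).eq_empty_or_nonempty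
      with hem | hne
    · refine ih _ ?_ (C := C.erase r) hpos (fun u hu w hw huw hlt => ?_) hnest (by omega) rfl
      · omega
      · refine Finset.mem_erase.2 ⟨fun hur => ?_, hcol u hu w hw huw hlt⟩
        exact Finset.notMem_empty u (hem ▸ Finset.mem_filter.2 ⟨hu, hur, w, hw, huw, hlt⟩)
    -- Take the leftmost left end `v` of an edge of colour `r`. By nesting, `v` is adjacent to the
    -- right end of every edge of colour `r`, so the colour disappears from the link of `v`,
    -- matching the drop from `s` to `s - 1`.
    · obtain ⟨v, hv, hmin⟩ := Finset.exists_min_image _ pos hne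
      rw [Finset.mem_filter] at hv
      have hlt := Finset.card_erase_add_one hv.1
      have hle := Finset.card_le_card (awayFrom_subset (G := G) W v)
      refine IndepAcyclic.of_erase_of_awayFrom hv.1
        (ih _ ?_ (W := W.erase v) (C := C) ?_ ?_ ?_ hs rfl)
        (ih _ ?_ (W := awayFrom G W v) (C := C.erase r) ?_ ?_ ?_ (by omega) rfl)
      · omega
      · exact fun u hu w hw => hpos u (Finset.mem_of_mem_erase hu) w (Finset.mem_of_mem_erase hw)
      · exact fun u hu w hw => hcol u (Finset.mem_of_mem_erase hu) w (Finset.mem_of_mem_erase hw)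
      · exact fun a ha u hu w hw => hnest a (Finset.mem_of_mem_erase ha) u
          (Finset.mem_of_mem_erase hu) w (Finset.mem_of_mem_erase hw)
      · omega
      · exact fun u hu w hw => hpos u (mem_awayFrom.1 hu).1 w (mem_awayFrom.1 hw).1
      · intro u hu w hw huw hlt
        rw [mem_awayFrom] at hu hw
        refine Finset.mem_erase.2 ⟨fun hur => ?_, hcol u hu.1 w hw.1 huw hlt⟩
        exact hw.2.2 (hnest v hv.1 u hu.1 w hw.1 huw hlt
          (hmin u (Finset.mem_filter.2 ⟨hu.1, hur, w, hw.1, huw, hlt⟩)) (hv.2.1.trans hur.symm))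
      · exact fun a ha u hu w hw => hnest a (mem_awayFrom.1 ha).1 u (mem_awayFrom.1 hu).1 w
          (mem_awayFrom.1 hw).1

end Criteria

/-! ### Independence complexes of induced subgraphs of `GA(t,k)'` -/

section CyclicGraph

variable {V : Type*} [DecidableEq V] [Fintype V] {K : Type*} [Field K] {G : SimpleGraph V}
  {t k : ℕ}

/-- `pos` enumerates the vertices of `G` in such a way that `G` becomes the graph `GA(t,k)'`. -/
structure IsAndrasfaiLabelling (G : SimpleGraph V) (t k : ℕ) (pos : V → ℕ) : Prop where
  injective : Function.Injective pos
  lt : ∀ v, pos v < t * (k - 1) + 2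
  surjective : ∀ i < t * (k - 1) + 2, ∃ v, pos v = i
  adj_iff : ∀ u v, pos u < pos v →
    (G.Adj u v ↔ ∃ j, 1 ≤ j ∧ j + 2 ≤ k ∧ pos v = pos u + 1 + j * t)

namespace IsAndrasfaiLabelling

variable {pos : V → ℕ} (hG : IsAndrasfaiLabelling G t k pos)

include hG

omit [DecidableEq V] [Fintype V] in
theorem adj_cases {u v : V} (h : G.Adj u v) :
    (∃ j, 1 ≤ j ∧ j + 2 ≤ k ∧ pos v = pos u + 1 + j * t) ∨
      ∃ j, 1 ≤ j ∧ j + 2 ≤ k ∧ pos u = pos v + 1 + j * t := by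
  have hne : pos u ≠ pos v := fun h' => h.ne (hG.injective h')
  rcases hne.lt_or_gt with h1 | h1
  · exact Or.inl ((hG.adj_iff u v h1).1 h)
  · exact Or.inr ((hG.adj_iff v u h1).1 h.symm)

omit [DecidableEq V] [Fintype V] in
/-- Away from the initial vertex the bound on the length of the edges is automatic. -/
theorem adj_of_eq (hk : 3 ≤ k) {u v : V} (hu : 1 ≤ pos u) {j : ℕ} (hj : 1 ≤ j)
    (h : pos v = pos u + 1 + j * t) : G.Adj u v := by
  refine (hG.adj_iff u v (by omega)).2 ⟨j, hj, ?_, h⟩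
  have := hG.lt v
  by_contra hlt
  obtain ⟨m, rfl⟩ : ∃ m, k = m + 1 := ⟨k - 1, by omega⟩
  -- An edge with `j ≥ k - 1` would have length at least `n - 1`, which does not fit when it starts
  -- at a position at least 1.
  have h2 : t * m ≤ j * t := by
    rw [mul_comm]
    exact Nat.mul_le_mul_right t (by omega)
  simp only [Nat.add_sub_cancel] at this
  omega

omit [Fintype V] in
-- Residues mod `t` of left ends are the colours. Moving a left end further left by a multiple of
-- `t` only increases `j`, which keeps the adjacency because position 0 is absent; this is the
-- Ferrers condition.
theorem indepAcyclic_of_lt (ht : 1 ≤ t) (hk : 3 ≤ k) {W : Finset V} (hW : ∀ v ∈ W, 1 ≤ pos v)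
    {s : ℤ} (hs : (t : ℤ) < s) : IndepAcyclic K G W s := by
  refine indepAcyclic_of_card_lt (pos := pos) (col := fun v => pos v % t) (C := Finset.range t)
    (fun u _ w _ h h' => h.ne (hG.injective h')) (fun u _ w _ _ _ => ?_) ?_ (by simpa using hs)
  · exact Finset.mem_range.2 (Nat.mod_lt _ ht)
  · intro v hv u hu w hw huw hlt hle hcol
    obtain ⟨j, hj, -, hw'⟩ := (hG.adj_iff u w hlt).1 huw
    obtain ⟨m, hm⟩ := (Nat.modEq_iff_dvd' hle).1 hcol
    refine hG.adj_of_eq hk (hW v hv) (j := m + j) (by omega) ?_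
    rw [add_mul, mul_comm m]
    omega

/-- Edges have length at least `t + 1`, so positions `1, …, t` are independent, and a neighbour of
one of them lies to its right and determines it by its residue mod `t`. -/
theorem indepAcyclic_of_le (hk : 3 ≤ k) {W : Finset V} {c : V} (hc : pos c = 0) (hcW : c ∉ W)
    {s : ℤ} (hs : s + (Wᶜ).card ≤ t) : IndepAcyclic K G W s := by
  classical
  have hT : (Finset.univ.filter fun v => 1 ≤ pos v ∧ pos v ≤ t).card = t := by
    rw [← Finset.card_image_of_injective _ hG.injective]
    have : (Finset.univ.filter fun v => 1 ≤ pos v ∧ pos v ≤ t).image pos = Finset.Icc 1 t := by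
      ext i
      simp only [Finset.mem_image, Finset.mem_filter, Finset.mem_univ, true_and, Finset.mem_Icc]
      constructor
      · rintro ⟨v, h, rfl⟩
        exact h
      · intro h
        have : i < t * (k - 1) + 2 := by
          have : t * 1 ≤ t * (k - 1) := Nat.mul_le_mul_left t (by omega)
          omega
        obtain ⟨v, rfl⟩ := hG.surjective i this
        exact ⟨v, h, rfl⟩
    rw [this]
    simp
  refine indepAcyclic_of_lt_card
    (S := (Finset.univ.filter fun v => 1 ≤ pos v ∧ pos v ≤ t) \ Wᶜ) ?_ ?_ ?_ ?_
  · intro v hv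
    simpa using (Finset.mem_sdiff.1 hv).2
  · intro u hu v hv _ h
    simp only [Finset.coe_sdiff, Set.mem_sdiff, Finset.mem_coe, Finset.mem_filter] at hu hv
    rcases hG.adj_cases h with ⟨j, hj, -, h⟩ | ⟨j, hj, -, h⟩ <;> nlinarith
  · intro v _ x hx y hy hvx hvy
    simp only [Finset.mem_sdiff, Finset.mem_filter] at hx hy
    apply hG.injective
    rcases hG.adj_cases hvx with ⟨i, hi, -, h⟩ | ⟨i, hi, -, h⟩
    · nlinarith
    rcases hG.adj_cases hvy with ⟨j, hj, -, h'⟩ | ⟨j, hj, -, h'⟩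
    · nlinarith
    have h3 : pos x ≡ pos y [MOD t] := by
      have h1 : pos x + 1 + i * t ≡ pos x + 1 [MOD t] := by simp [Nat.ModEq]
      have h2 : pos y + 1 + j * t ≡ pos y + 1 [MOD t] := by simp [Nat.ModEq]
      refine Nat.ModEq.add_right_cancel' 1 (h1.symm.trans ?_)
      rw [← h, h']
      exact h2
    have h4 : pos x - 1 = pos y - 1 := by
      refine Nat.ModEq.eq_of_lt_of_lt (m := t) ?_ (by omega) (by omega)
      refine Nat.ModEq.add_right_cancel' 1 ?_
      rwa [Nat.sub_add_cancel hx.1.2.1, Nat.sub_add_cancel hy.1.2.1]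
    omega
  -- The missing vertex `c` sits at position 0, outside `1, …, t`. Hence at most `|Wᶜ| - 1` of these
  -- positions are lost, which gives the strict inequality needed.
  · have h1 : ((Finset.univ.filter fun v => 1 ≤ pos v ∧ pos v ≤ t) \ Wᶜ) =
        (Finset.univ.filter fun v => 1 ≤ pos v ∧ pos v ≤ t) \ (Wᶜ.erase c) := by
      ext v
      simp only [Finset.mem_sdiff, Finset.mem_filter, Finset.mem_erase]
      constructor
      · exact fun h => ⟨h.1, fun h' => h.2 h'.2⟩
      · refine fun h => ⟨h.1, fun h' => h.2 ⟨fun h'' => ?_, h'⟩⟩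
        rw [h'', hc] at h
        omega
    rw [h1]
    have h2 := Finset.le_card_sdiff (Wᶜ.erase c) (Finset.univ.filter fun v => 1 ≤ pos v ∧ pos v ≤ t)
    have h3 := Finset.card_erase_add_one (Finset.mem_compl.2 hcW)
    omega

omit [Fintype V] in
/-- The independence complex on a final interval is acyclic. -/
theorem indepAcyclic_ge (ht : 1 ≤ t) (hk : 3 ≤ k) {b : ℕ} (hb : 1 ≤ b) (hbn : b ≤ t * (k - 1) + 1)
    {W : Finset V} (hW : ∀ v, v ∈ W ↔ b ≤ pos v) (s : ℤ) : IndepAcyclic K G W s := by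
  induction h : t * (k - 1) + 1 - b generalizing b W s with
  | zero =>
    obtain ⟨v, hv⟩ := hG.surjective b (by omega)
    refine indepAcyclic_of_isolated ((hW v).2 hv.ge) (fun w hw h => h.ne (hG.injective ?_)) s
    have := hG.lt w
    have := (hW w).1 hw
    omega
  | succ d ih =>
    obtain ⟨v, hv⟩ := hG.surjective b (by omega)
    have hvW := (hW v).2 hv.ge
    by_cases hbt : t * (k - 1) + 1 < b + 1 + t
    · refine indepAcyclic_of_isolated hvW (fun w hw hvw => ?_) s
      have h1 := hG.lt w
      have h2 := (hW w).1 hw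
      rcases hG.adj_cases hvw with ⟨j, hj, -, h⟩ | ⟨j, hj, -, h⟩ <;> nlinarith
    -- The vertex at `b + t` is too close to be adjacent to the one at `b`, but each of its right
    -- neighbours is a neighbour of the latter, and its left neighbours lie before `b`. It is
    -- therefore isolated in the link.
    · obtain ⟨u, hu⟩ := hG.surjective (b + t) (by omega)
      refine IndepAcyclic.of_erase_of_awayFrom hvW
        (ih (b := b + 1) (by omega) (by omega) (fun w => ?_) s (by omega))
        (indepAcyclic_of_isolated (v := u) ?_ (fun w hw huw => ?_) _)
      · rw [Finset.mem_erase, hW, ← hG.injective.ne_iff, hv]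
        omega
      · refine mem_awayFrom.2 ⟨(hW u).2 (by omega), fun h => ?_, fun h => ?_⟩
        · rw [h, hv] at hu
          omega
        · rcases hG.adj_cases h with ⟨j, hj, -, h⟩ | ⟨j, hj, -, h⟩ <;> nlinarith
      · obtain ⟨hwW, -, hvw⟩ := mem_awayFrom.1 hw
        have h2 := (hW w).1 hwW
        rcases hG.adj_cases huw with ⟨j, hj, -, h⟩ | ⟨j, hj, -, h⟩
        · refine hvw (hG.adj_of_eq hk (j := j + 1) (by omega) (by omega) ?_)
          rw [add_mul]
          omega
        · nlinarith

omit [Fintype V] in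
/-- The independence complex on the vertices that remain after the closed neighbourhoods of the
first `r + 1` vertices have been removed has the cohomology of a sphere. -/
theorem indepLine_of_mem_iff (ht : 1 ≤ t) (hk : 3 ≤ k) {r : ℕ} (hr : r < t)
    {W : Finset V} (hW : ∀ v, v ∈ W ↔ pos v = r + 1 ∨ pos v = t * (k - 1) + 1 ∨
      1 ≤ pos v ∧ pos v ≤ t * (k - 1) ∧ r < (pos v - 1) % t) :
    IndepLine K G W ((t - r : ℕ) : ℤ) ∧ ∀ s : ℤ, s ≠ (t - r : ℕ) → IndepAcyclic K G W s := by
  -- The neighbours of position `i` to its right have `pos - 1` congruent to `i` mod `t`, so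
  -- removing positions `0, …, r` with their neighbours leaves the residues above `r`. The two
  -- exceptions, `r + 1` and the last position `n - 1`, survive because the exterior edges from `r`
  -- to `r + 1` and from `0` to `n - 1` were deleted.
  obtain ⟨m, rfl⟩ : ∃ m, k = m + 3 := ⟨k - 3, by omega⟩
  rw [show m + 3 - 1 = m + 2 by omega] at hW
  have hlt := hG.lt
  have hsur := hG.surjective
  rw [show m + 3 - 1 = m + 2 by omega] at hlt hsur
  have hm : t * (m + 2) = m * t + 2 * t := by ring
  rw [hm] at hW hlt hsur
  induction h : t - 1 - r generalizing r W with
  | zero =>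
    obtain ⟨v, hv⟩ := hsur (r + 1) (by omega)
    obtain ⟨w, hw⟩ := hsur (m * t + 2 * t + 1) (by omega)
    -- For `r = t - 1` only positions `t` and `n - 1` are left, joined by the longest edge, `j = k -
    -- 2`. Two adjacent vertices give a 0-sphere.
    have hvw : G.Adj v w := by
      refine hG.adj_of_eq hk (by omega) (j := m + 1) (by omega) ?_
      rw [add_mul]
      omega
    have hWmem : ∀ x, x ∈ W ↔ x = v ∨ x = w := by
      intro x
      rw [hW, ← hG.injective.eq_iff (a := x), ← hG.injective.eq_iff (a := x), hv, hw]
      have := Nat.mod_lt (pos x - 1) (show 0 < t by omega)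
      omega
    have hvW := (hWmem v).2 (Or.inl rfl)
    have he : ∀ s : ℤ, IndepAcyclic K G (W.erase v) s := by
      refine indepAcyclic_of_isolated (v := w) (Finset.mem_erase.2 ⟨hvw.ne', (hWmem w).2
        (Or.inr rfl)⟩) (fun x hx hwx => ?_)
      rw [Finset.mem_erase, hWmem] at hx
      exact hwx.ne' (hx.2.resolve_left hx.1)
    have ha : awayFrom G W v = ∅ := by
      rw [Finset.eq_empty_iff_forall_notMem]
      intro x hx
      rw [mem_awayFrom, hWmem] at hx
      rcases hx with ⟨rfl | rfl, h1, h2⟩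
      · exact h1 rfl
      · exact h2 hvw
    have htr : t - r = 1 := by omega
    rw [htr]
    refine ⟨IndepLine.of_erase_of_awayFrom hvW he ?_, fun s hs =>
      IndepAcyclic.of_erase_of_awayFrom hvW (he s) ?_⟩
    · rw [ha]
      exact indepLine_empty
    · rw [ha]
      refine indepAcyclic_empty ?_
      push_cast at hs
      omega
  | succ d ih =>
    obtain ⟨v, hv⟩ := hsur (r + 1) (by omega)
    have hvW : v ∈ W := (hW v).2 (Or.inl hv)
    -- This vertex has no right neighbours, and its left neighbours are at positions `r + 1 + i *
    -- t`, of residue `r`. The only such vertex in `W` is `v`, so `u` is isolated once `v` is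
    -- deleted.
    obtain ⟨u, hu⟩ := hsur (r + 2 + (m + 1) * t) (by rw [add_mul]; omega)
    have hmt : (m + 1) * t = m * t + t := by ring
    have he : ∀ s : ℤ, IndepAcyclic K G (W.erase v) s := by
      refine indepAcyclic_of_isolated (v := u) (Finset.mem_erase.2 ⟨fun h => ?_, (hW u).2 ?_⟩) ?_
      · rw [h] at hu
        omega
      · refine Or.inr (Or.inr ⟨by omega, by omega, ?_⟩)
        rw [hu, show r + 2 + (m + 1) * t - 1 = r + 1 + (m + 1) * t by omega,
          Nat.add_mul_mod_self_right, Nat.mod_eq_of_lt (by omega)]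
        omega
      · intro w hw huw
        rw [Finset.mem_erase, hW, ← hG.injective.ne_iff, hv] at hw
        have h1 := hlt w
        rcases hG.adj_cases huw with ⟨j, hj, -, h⟩ | ⟨j, hj, hjk, h⟩
        · nlinarith
        · obtain ⟨i, hi⟩ : ∃ i, m + 1 = j + i := ⟨m + 1 - j, by omega⟩
          rw [hi] at hu hmt
          have hw' : pos w = r + 1 + i * t := by
            have : (j + i) * t = j * t + i * t := by ring
            omega
          have hjt : 1 * t ≤ j * t := Nat.mul_le_mul_right t hj
          have : (pos w - 1) % t = r := by
            rw [hw', show r + 1 + i * t - 1 = r + i * t by omega, Nat.add_mul_mod_self_right,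
              Nat.mod_eq_of_lt hr]
          omega
    have ha : ∀ w, w ∈ awayFrom G W v ↔ pos w = r + 1 + 1 ∨ pos w = m * t + 2 * t + 1 ∨
        1 ≤ pos w ∧ pos w ≤ m * t + 2 * t ∧ r + 1 < (pos w - 1) % t := by
      intro w
      have hdiv := Nat.mod_add_div (pos w - 1) t
      have hwlt := hlt w
      rw [mul_comm] at hdiv
      rw [mem_awayFrom, hW, ← hG.injective.ne_iff, hv]
      constructor
      · rintro ⟨h1 | h1 | ⟨h1, h2, h3⟩, h4, h5⟩
        · exact absurd h1 h4
        · exact Or.inr (Or.inl h1)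
        · rcases (Nat.succ_le_of_lt h3).lt_or_eq with h6 | h6
          · exact Or.inr (Or.inr ⟨h1, h2, h6⟩)
          · refine Or.inl ?_
            by_contra hne
            -- Among the vertices whose `pos - 1` has residue `r + 1`, only position `r + 2` has
            -- quotient 0; all others are neighbours of `v`.
            have hq : 1 ≤ (pos w - 1) / t := by
              rw [Nat.one_le_iff_ne_zero]
              intro h0
              rw [h0] at hdiv
              omega
            exact h5 (hG.adj_of_eq hk (by omega) hq (by omega))
      · have hadj : G.Adj v w → ∃ j, 1 ≤ j ∧ pos w = r + 2 + j * t := by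
          intro h
          rcases hG.adj_cases h with ⟨j, hj, -, h⟩ | ⟨j, hj, -, h⟩
          · exact ⟨j, hj, by omega⟩
          · have := Nat.mul_le_mul_right t hj
            omega
        rintro (h1 | h1 | ⟨h1, h2, h3⟩)
        · refine ⟨Or.inr (Or.inr ⟨by omega, by omega, ?_⟩), by omega, fun h => ?_⟩
          · rw [h1, Nat.add_sub_cancel, Nat.mod_eq_of_lt (by omega)]
            omega
          · obtain ⟨j, hj, h⟩ := hadj h
            have := Nat.mul_le_mul_right t hj
            omega
        · refine ⟨Or.inr (Or.inl h1), by omega, fun h => ?_⟩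
          obtain ⟨j, hj, h⟩ := hadj h
          -- The last position is not a neighbour of `v`, since that would force `r + 1` to be
          -- divisible by `t`.
          have h2 : (r + 1 + j * t) % t = (0 + (m + 2) * t) % t := by
            congr 1
            rw [add_mul]
            omega
          rw [Nat.add_mul_mod_self_right, Nat.add_mul_mod_self_right,
            Nat.mod_eq_of_lt (by omega), Nat.zero_mod] at h2
          omega
        · refine ⟨Or.inr (Or.inr ⟨h1, h2, by omega⟩), fun h => ?_, fun h => ?_⟩
          · rw [h, Nat.add_sub_cancel, Nat.mod_eq_of_lt hr] at h3
            omega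
          · obtain ⟨j, hj, h⟩ := hadj h
            rw [h, show r + 2 + j * t - 1 = r + 1 + j * t by omega, Nat.add_mul_mod_self_right,
              Nat.mod_eq_of_lt (by omega)] at h3
            omega
    have := ih (by omega) ha (by omega)
    refine ⟨IndepLine.of_erase_of_awayFrom hvW he ?_, fun s hs =>
      IndepAcyclic.of_erase_of_awayFrom hvW (he s) (this.2 _ (by omega))⟩
    rw [show ((t - r : ℕ) : ℤ) - 1 = ((t - (r + 1) : ℕ) : ℤ) by omega]
    exact this.1

/-- Deleting position 0 leaves a final interval, which is acyclic, and the link of position 0 is the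
case `r = 0` of `indepLine_of_mem_iff`, with its class at `t`; the link shift moves it to `t + 1`.
-/
theorem indepLine_univ (ht : 1 ≤ t) (hk : 3 ≤ k) :
    IndepLine K G (Finset.univ : Finset V) (t + 1) ∧
      ∀ s : ℤ, s ≠ t + 1 → IndepAcyclic K G (Finset.univ : Finset V) s := by
  obtain ⟨v, hv⟩ := hG.surjective 0 (by omega)
  have he : ∀ s : ℤ, IndepAcyclic K G (Finset.univ.erase v) s := by
    refine hG.indepAcyclic_ge ht hk le_rfl (by omega) fun w => ?_
    rw [Finset.mem_erase, ← hG.injective.ne_iff, hv, Nat.one_le_iff_ne_zero]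
    simp
  have ha := hG.indepLine_of_mem_iff (K := K) ht hk (r := 0) ht (W := awayFrom G Finset.univ v) (by
    intro w
    have hdiv := Nat.mod_add_div (pos w - 1) t
    have hwlt := hG.lt w
    rw [mul_comm] at hdiv
    rw [mem_awayFrom, ← hG.injective.ne_iff, hv]
    constructor
    · rintro ⟨-, h4, h5⟩
      by_contra! hcon
      have h6 : pos w = 0 + 1 + (pos w - 1) / t * t := by
        have := hcon.2.2 (by omega) (by omega)
        omega
      refine h5 ((hG.adj_iff v w (by omega)).2 ⟨(pos w - 1) / t, ?_, ?_, by rwa [hv]⟩)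
      · rw [Nat.one_le_iff_ne_zero]
        intro h0
        rw [h0] at h6
        omega
      -- A quotient at least `k - 1` puts `w` at the last position, which is one of the listed
      -- survivors.
      · by_contra hlt
        have := Nat.mul_le_mul_right t (show k - 1 ≤ (pos w - 1) / t by omega)
        rw [mul_comm] at this
        omega
    · intro h1
      refine ⟨Finset.mem_univ _, by omega, fun h => ?_⟩
      rcases hG.adj_cases h with ⟨j, hj, hjk, h⟩ | ⟨j, hj, -, h⟩
      · rw [hv] at h
        rcases h1 with h1 | h1 | ⟨-, -, h1⟩
        · have := Nat.mul_le_mul_right t hj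
          omega
        · have h2 : (j + 1) * t ≤ (k - 1) * t := Nat.mul_le_mul_right t (by omega)
          rw [add_mul, mul_comm (k - 1)] at h2
          omega
        · rw [h, show 0 + 1 + j * t - 1 = 0 + j * t by omega, Nat.add_mul_mod_self_right] at h1
          simp at h1
      · omega)
  refine ⟨IndepLine.of_erase_of_awayFrom (Finset.mem_univ v) he ?_, fun s hs =>
    IndepAcyclic.of_erase_of_awayFrom (Finset.mem_univ v) (he s) (ha.2 _ (by omega))⟩
  simpa using ha.1

end IsAndrasfaiLabelling

end CyclicGraph

/-! ### Cutting the cyclic graph open at a vertex -/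

section Labelling

/-- The connection set is symmetric under `j ↦ k - 1 - j`, and its extreme elements `j = 0` and `j =
k - 1` are `1` and `-1`. Removing the exterior cycle therefore leaves `1 ≤ j ≤ k - 2`. -/
theorem generalizedAndrasfai'_adj_iff {t k : ℕ} (ht : 1 ≤ t) (hk : 3 ≤ k)
    (u v : ZMod (t * (k - 1) + 2)) : (generalizedAndrasfai' t k).Adj u v ↔
      ∃ j, 1 ≤ j ∧ j + 2 ≤ k ∧ v - u = ((1 + j * t : ℕ) : ZMod (t * (k - 1) + 2)) := by
  obtain ⟨m, rfl⟩ : ∃ m, k = m + 1 := ⟨k - 1, by omega⟩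
  have hsum : ∀ j ≤ m, ((1 + j * t : ℕ) : ZMod (t * (m + 1 - 1) + 2)) =
      -((1 + (m - j) * t : ℕ) : ZMod (t * (m + 1 - 1) + 2)) := by
    intro j hj
    rw [eq_neg_iff_add_eq_zero, ← Nat.cast_add, ZMod.natCast_eq_zero_iff]
    obtain ⟨i, rfl⟩ := Nat.exists_eq_add_of_le hj
    refine dvd_of_eq ?_
    simp only [Nat.add_sub_cancel, Nat.add_sub_cancel_left]
    ring
  have hinj : ∀ a b : ℕ, a < t * (m + 1 - 1) + 2 → b < t * (m + 1 - 1) + 2 →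
      (a : ZMod (t * (m + 1 - 1) + 2)) = b → a = b := by
    intro a b ha hb h
    rwa [ZMod.natCast_eq_natCast_iff', Nat.mod_eq_of_lt ha, Nat.mod_eq_of_lt hb] at h
  have hone : ∀ x : ZMod (t * (m + 1 - 1) + 2), -x = 1 ↔ x = ((1 + m * t : ℕ) : ZMod _) := by
    intro x
    rw [neg_eq_iff_eq_neg, hsum m le_rfl]
    simp
  have key : (generalizedAndrasfai' t (m + 1)).Adj u v ↔ u ≠ v ∧
      (∃ j ≤ m, v - u = ((1 + j * t : ℕ) : ZMod _)) ∧ v - u ≠ 1 ∧ -(v - u) ≠ 1 := by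
    simp only [generalizedAndrasfai', generalizedAndrasfai, exteriorCycle, SimpleGraph.sdiff_adj,
      SimpleGraph.circulantGraph, SimpleGraph.fromRel_adj, Set.mem_ofPred_eq,
      Set.mem_singleton_iff, neg_sub]
    have : (∃ j < m + 1, u - v = ((1 + j * t : ℕ) : ZMod (t * (m + 1 - 1) + 2))) ↔
        ∃ j < m + 1, v - u = ((1 + j * t : ℕ) : ZMod (t * (m + 1 - 1) + 2)) := by
      constructor <;>
      · rintro ⟨j, hj, h⟩
        refine ⟨m - j, by omega, ?_⟩
        rw [hsum _ (Nat.sub_le _ _), Nat.sub_sub_self (by omega), ← h, neg_sub]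
    rw [this, or_self]
    simp only [Nat.lt_succ_iff]
    tauto
  rw [key]
  constructor
  · rintro ⟨-, ⟨j, hj, h⟩, h1, h2⟩
    refine ⟨j, ?_, ?_, h⟩
    · rw [Nat.one_le_iff_ne_zero]
      rintro rfl
      exact h1 (by simpa using h)
    · by_contra hlt
      obtain rfl : j = m := by omega
      exact h2 ((hone _).2 h)
  · rintro ⟨j, hj, hjk, h⟩
    have h3 := Nat.mul_le_mul_right t hj
    have h4 : (j + 1) * t ≤ m * t := Nat.mul_le_mul_right t (by omega)
    have h5 : m * t = t * (m + 1 - 1) := by rw [mul_comm, Nat.add_sub_cancel]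
    rw [add_mul] at h4
    refine ⟨fun huv => ?_, ⟨j, by omega, h⟩, fun h' => ?_, fun h' => ?_⟩
    · rw [huv, sub_self, ← Nat.cast_zero] at h
      have := hinj _ _ (by omega) (by omega) h
      omega
    · rw [h] at h'
      have := hinj _ _ (by omega) (by omega) (h'.trans Nat.cast_one.symm)
      omega
    · rw [hone, h] at h'
      have := hinj _ _ (by omega) (by omega) h'
      omega

/-- By rotation invariance any vertex `c` may be put at position 0; it will be chosen outside the
vertex set under study. -/
theorem isAndrasfaiLabelling_val_sub {t k : ℕ} (ht : 1 ≤ t) (hk : 3 ≤ k) (c : ZMod (t * (k - 1) + 2)) :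
    IsAndrasfaiLabelling (generalizedAndrasfai' t k) t k (fun v => (v - c).val) where
  injective := fun u v h => sub_left_injective (ZMod.val_injective _ h)
  lt := fun v => ZMod.val_lt _
  surjective := fun i hi => ⟨(i : ZMod _) + c, by
    show ((i : ZMod _) + c - c).val = i
    rw [add_sub_cancel_right, ZMod.val_natCast_of_lt hi]⟩
  adj_iff := by
    intro u v huv
    rw [generalizedAndrasfai'_adj_iff ht hk]
    refine exists_congr fun j => and_congr_right fun hj => and_congr_right fun hjk => ?_
    have h1 : v - u = (((v - c).val - (u - c).val : ℕ) : ZMod (t * (k - 1) + 2)) := by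
      rw [Nat.cast_sub huv.le, ZMod.natCast_zmod_val, ZMod.natCast_zmod_val]
      ring
    have h2 : 1 + j * t < t * (k - 1) + 2 := by
      have : j * t ≤ (k - 1) * t := Nat.mul_le_mul_right t (by omega)
      rw [mul_comm (k - 1)] at this
      omega
    have h3 := ZMod.val_lt (v - c)
    rw [h1, ZMod.natCast_eq_natCast_iff', Nat.mod_eq_of_lt h2, Nat.mod_eq_of_lt (by omega)]
    omega

end Labelling

/-! ### Cochains of a simplex relative to the independence complex -/

section DependenceCochains

variable {V : Type*} [DecidableEq V] [Fintype V] {K : Type*} [Field K] {G : SimpleGraph V}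

/-- `φ` is supported on the sets with `q` elements containing the complement of `W`. -/
def IsCochainOn (W : Finset V) (q : ℤ) (φ : Finset V → K) : Prop :=
  ∀ τ, φ τ ≠ 0 → τᶜ ⊆ W ∧ (τ.card : ℤ) = q

variable (G) in
/-- `φ` is a cochain on the sets containing the complement of `W` that meet `W` in a set which is
not independent. -/
def IsDepCochainOn (W : Finset V) (q : ℤ) (φ : Finset V → K) : Prop :=
  IsCochainOn W q φ ∧ ∀ τ, φ τ ≠ 0 → ¬ G.IsIndepSet ((τ ∩ W : Finset V) : Set V)

theorem IsCochainOn.sub {W : Finset V} {q : ℤ} {φ ψ : Finset V → K} (hφ : IsCochainOn W q φ)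
    (hψ : IsCochainOn W q ψ) : IsCochainOn W q (φ - ψ) := by
  intro τ hτ
  by_cases h : φ τ = 0
  · refine hψ τ fun h' => hτ ?_
    rw [Pi.sub_apply, h, h', sub_zero]
  · exact hφ τ h

theorem IsCochainOn.smul {W : Finset V} {q : ℤ} {φ : Finset V → K} (hφ : IsCochainOn W q φ)
    (r : K) : IsCochainOn W q (r • φ) :=
  fun τ hτ => hφ τ fun h => hτ (by rw [Pi.smul_apply, h, smul_zero])

theorem IsCochainOn.coboundary {W : Finset V} {q : ℤ} {φ : Finset V → K}
    (hφ : IsCochainOn W (q - 1) φ) (ε : Finset V → V → K) :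
    IsCochainOn W q (coboundary ε φ) := by
  intro τ hτ
  obtain ⟨v, hv, hne⟩ := Finset.exists_ne_zero_of_sum_ne_zero hτ
  obtain ⟨h1, h2⟩ := hφ _ (right_ne_zero_of_smul hne)
  have := Finset.card_erase_add_one hv
  refine ⟨fun x hx => h1 ?_, by omega⟩
  rw [Finset.mem_compl] at hx ⊢
  exact fun h => hx (Finset.mem_of_mem_erase h)

theorem IsCochainOn.contractCone {W : Finset V} {q : ℤ} {φ : Finset V → K}
    (hφ : IsCochainOn W q φ) (ε : Finset V → V → K) {v : V} (hv : v ∈ W) :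
    IsCochainOn W (q - 1) (contractCone ε v φ) := by
  intro τ hτ
  rw [_root_.contractCone] at hτ
  split_ifs at hτ with hvτ
  · exact absurd rfl hτ
  · obtain ⟨h1, h2⟩ := hφ _ (right_ne_zero_of_mul hτ)
    rw [Finset.card_insert_of_notMem hvτ] at h2
    refine ⟨fun x hx => ?_, by push_cast at h2; omega⟩
    by_cases hxv : x = v
    · exact hxv ▸ hv
    · exact h1 (by simpa [hxv] using hx)

theorem compl_subset_union {W τ : Finset V} : (Wᶜ ∪ τ)ᶜ ⊆ W := by
  intro x hx
  simp at hx
  exact hx.1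

theorem card_compl_union {W τ : Finset V} (hτ : τ ⊆ W) :
    ((Wᶜ ∪ τ).card : ℤ) = Fintype.card V - W.card + τ.card := by
  rw [Finset.card_union_of_disjoint, Finset.card_compl]
  · have := Finset.card_le_univ W
    push_cast [this]
    ring
  · exact Finset.disjoint_left.2 fun x hx hx' => Finset.mem_compl.1 hx (hτ hx')

theorem compl_union_inter {W τ : Finset V} (hτ : τ ⊆ W) : (Wᶜ ∪ τ) ∩ W = τ := by
  ext x
  have := @hτ x
  simp
  tauto

theorem eq_compl_union_inter {W τ : Finset V} (hτ : τᶜ ⊆ W) : Wᶜ ∪ (τ ∩ W) = τ := by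
  ext x
  have := @hτ x
  simp at this ⊢
  tauto

/-- Terms that remove an element of `Wᶜ` vanish by the support condition, so the coboundary is that
of the simplex on `W` with translated weights. -/
theorem coboundary_compl_union {W : Finset V} {q : ℤ} {φ : Finset V → K} (hφ : IsCochainOn W q φ)
    (ε : Finset V → V → K) {τ : Finset V} (hτ : τ ⊆ W) :
    coboundary ε φ (Wᶜ ∪ τ) = coboundary (fun τ => ε (Wᶜ ∪ τ)) (fun τ => φ (Wᶜ ∪ τ)) τ := by
  have hd : Disjoint Wᶜ τ :=
    Finset.disjoint_left.2 fun x hx hx' => Finset.mem_compl.1 hx (hτ hx')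
  rw [coboundary_apply, Finset.sum_union hd, Finset.sum_eq_zero, zero_add, coboundary_apply]
  · refine Finset.sum_congr rfl fun v hv => ?_
    have hvW := hτ hv
    have : (Wᶜ ∪ τ).erase v = Wᶜ ∪ τ.erase v := by
      ext x
      by_cases hx : x = v <;> simp [hx, hvW]
    rw [this]
  · intro v hv
    by_contra hne
    have := (hφ _ (right_ne_zero_of_smul hne)).1
    exact Finset.mem_compl.1 hv (this (by simp))

theorem IsAlternatingOn.compl_union {ε : Finset V → V → K} (hε : IsAlternatingOn Finset.univ ε)
    (W : Finset V) : IsAlternatingOn W (fun τ => ε (Wᶜ ∪ τ)) := by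
  intro τ u v hτ hu hv huτ hvτ huv
  have := hε (Wᶜ ∪ τ) u v (Finset.subset_univ _) (Finset.mem_univ _) (Finset.mem_univ _)
    (by simp [hu, huτ]) (by simp [hv, hvτ]) huv
  rwa [← Finset.union_insert, ← Finset.union_insert] at this

open Classical in
/-- Extension by zero of a cochain on the subsets of `W`. -/
noncomputable def extendCochain (W : Finset V) (q : ℤ) (g : Finset V → K) (τ : Finset V) : K :=
  if τᶜ ⊆ W ∧ (τ.card : ℤ) = q then g (τ ∩ W) else 0

theorem isCochainOn_extendCochain (W : Finset V) (q : ℤ) (g : Finset V → K) :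
    IsCochainOn W q (extendCochain W q g) := by
  intro τ hτ
  by_contra h
  exact hτ (if_neg h)

theorem extendCochain_compl_union {W : Finset V} {q : ℤ} (g : Finset V → K) {τ : Finset V}
    (hτ : τ ⊆ W) (hq : (τ.card : ℤ) = q - Fintype.card V + W.card) :
    extendCochain W q g (Wᶜ ∪ τ) = g τ := by
  rw [extendCochain, if_pos ⟨compl_subset_union, by rw [card_compl_union hτ]; omega⟩,
    compl_union_inter hτ]

theorem coboundary_extendCochain {W : Finset V} {q : ℤ} (g : Finset V → K) {τ : Finset V}
    (ε : Finset V → V → K) (hτ : τ ⊆ W) (hq : (τ.card : ℤ) = q + 1 - Fintype.card V + W.card) :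
    coboundary ε (extendCochain W q g) (Wᶜ ∪ τ) = coboundary (fun τ => ε (Wᶜ ∪ τ)) g τ := by
  rw [coboundary_compl_union (isCochainOn_extendCochain W q g) ε hτ]
  refine coboundary_congr fun v hv => extendCochain_compl_union g
    ((Finset.erase_subset _ _).trans hτ) ?_
  have := Finset.card_erase_add_one hv
  omega

theorem isDepCochainOn_of_forall {W : Finset V} {q : ℤ} {φ : Finset V → K}
    (hφ : IsCochainOn W q φ) (h : ∀ τ ⊆ W, G.IsIndepSet (τ : Set V) →
      (τ.card : ℤ) = q - Fintype.card V + W.card → φ (Wᶜ ∪ τ) = 0) : IsDepCochainOn G W q φ := by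
  refine ⟨hφ, fun τ hτ hi => hτ ?_⟩
  obtain ⟨h1, h2⟩ := hφ τ hτ
  have h3 := card_compl_union (W := W) (τ := τ ∩ W) Finset.inter_subset_right
  rw [eq_compl_union_inter h1] at h3
  have := h (τ ∩ W) Finset.inter_subset_right hi (by omega)
  rwa [eq_compl_union_inter h1] at this

theorem IsDepCochainOn.apply_eq_zero {W : Finset V} {q : ℤ} {φ : Finset V → K}
    (hφ : IsDepCochainOn G W q φ) {τ : Finset V} (hτ : τ ⊆ W) (hi : G.IsIndepSet (τ : Set V)) :
    φ (Wᶜ ∪ τ) = 0 := by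
  by_contra h
  have := hφ.2 _ h
  rw [compl_union_inter hτ] at this
  exact this hi

variable {W : Finset V} {ε : Finset V → V → K}

/-- A full nonempty simplex is contractible towards any of its vertices. -/
theorem exists_coboundary_eq_of_isCochainOn (hW : W.Nonempty)
    (hε : IsAlternatingOn Finset.univ ε) (h0 : ∀ τ v, ε τ v ≠ 0) {q : ℤ} {φ : Finset V → K}
    (hφ : IsCochainOn W q φ) (hz : coboundary ε φ = 0) :
    ∃ χ, IsCochainOn W (q - 1) χ ∧ coboundary ε χ = φ := by
  obtain ⟨v, hv⟩ := hW
  exact ⟨contractCone ε v φ, hφ.contractCone ε hv, funext fun τ =>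
    coboundary_contractCone hε h0 (Finset.mem_univ v) φ (Finset.subset_univ _)
      fun _ => congrFun hz _⟩

theorem coboundary_coboundary_eq_zero (hε : IsAlternatingOn Finset.univ ε) (f : Finset V → K) :
    coboundary ε (coboundary ε f) = 0 :=
  funext fun _ => coboundary_coboundary hε f (Finset.subset_univ _)

/-- If `χ` restricts to a coboundary on the independent sets then it can be changed by a coboundary
so that it vanishes there. -/
theorem exists_isDepCochainOn_sub {q s : ℤ} (hs : s = q - 1 - Fintype.card V + W.card)
    {χ g : Finset V → K} (hχ : IsCochainOn W (q - 1) χ) (hε : IsAlternatingOn Finset.univ ε)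
    (hg : ∀ τ ⊆ W, G.IsIndepSet (τ : Set V) → (τ.card : ℤ) = s →
      χ (Wᶜ ∪ τ) = coboundary (fun τ => ε (Wᶜ ∪ τ)) g τ) :
    ∃ ψ, IsDepCochainOn G W (q - 1) ψ ∧ coboundary ε ψ = coboundary ε χ := by
  refine ⟨χ - coboundary ε (extendCochain W (q - 1 - 1) g), isDepCochainOn_of_forall
    (hχ.sub ((isCochainOn_extendCochain W _ g).coboundary ε)) fun τ hτ hi hc => ?_, ?_⟩
  · rw [Pi.sub_apply, hg τ hτ hi (by omega), coboundary_extendCochain g ε hτ (by omega), sub_self]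
  · rw [map_sub, coboundary_coboundary_eq_zero hε, sub_zero]

theorem isIndepCocycle_of_isDepCochainOn {q s : ℤ} {χ : Finset V → K}
    (hχ : IsCochainOn W (q - 1) χ) (hφ : IsDepCochainOn G W q (coboundary ε χ)) :
    IsIndepCocycle K G W s (fun τ => ε (Wᶜ ∪ τ)) (fun τ => χ (Wᶜ ∪ τ)) := by
  intro τ hτ hi _
  rw [← coboundary_compl_union hχ ε hτ, hφ.apply_eq_zero hτ hi]

/-- As the full simplex is acyclic, relative cohomology at `q` is the cohomology of the independence
complex one step lower. A set of size `q - 1` containing `Wᶜ` meets `W` in `q - 1 - |V| + |W|`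
elements, whence `s`. -/
theorem IndepAcyclic.exists_coboundary_eq (hW : W.Nonempty) {q s : ℤ}
    (hs : s = q - 1 - Fintype.card V + W.card) (h : IndepAcyclic K G W s)
    (hε : IsAlternatingOn Finset.univ ε) (h0 : ∀ τ v, ε τ v ≠ 0) {φ : Finset V → K}
    (hφ : IsDepCochainOn G W q φ) (hz : coboundary ε φ = 0) :
    ∃ ψ, IsDepCochainOn G W (q - 1) ψ ∧ coboundary ε ψ = φ := by
  obtain ⟨χ, hχ, rfl⟩ := exists_coboundary_eq_of_isCochainOn hW hε h0 hφ.1 hz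
  obtain ⟨g, hg⟩ := h _ (hε.compl_union W) (fun _ _ => h0 _ _) _
    (isIndepCocycle_of_isDepCochainOn hχ hφ)
  exact exists_isDepCochainOn_sub hs hχ hε hg

theorem IndepLine.exists_coboundary_eq (hW : W.Nonempty) {q s : ℤ}
    (hs : s = q - 1 - Fintype.card V + W.card) (h : IndepLine K G W s)
    (hε : IsAlternatingOn Finset.univ ε) (h0 : ∀ τ v, ε τ v ≠ 0) :
    ∃ ω, IsDepCochainOn G W q ω ∧ coboundary ε ω = 0 ∧
      (¬ ∃ ψ, IsDepCochainOn G W (q - 1) ψ ∧ coboundary ε ψ = ω) ∧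
      ∀ φ, IsDepCochainOn G W q φ → coboundary ε φ = 0 →
        ∃ (r : K) (ψ : Finset V → K), IsDepCochainOn G W (q - 1) ψ ∧
          φ = r • ω + coboundary ε ψ := by
  obtain ⟨ω, hω, hne, hspan⟩ := h _ (hε.compl_union W) (fun _ _ => h0 _ _)
  have hext := isCochainOn_extendCochain W (q - 1) ω
  refine ⟨coboundary ε (extendCochain W (q - 1) ω),
    isDepCochainOn_of_forall (hext.coboundary ε) fun τ hτ hi hc => ?_,
    coboundary_coboundary_eq_zero hε _, ?_, fun φ hφ hz => ?_⟩
  · rw [coboundary_extendCochain ω ε hτ (by omega), hω τ hτ hi (by omega)]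
  · rintro ⟨ψ, hψ, h⟩
    -- The difference between the extension of `ω` and `ψ` is closed, hence a coboundary on the
    -- simplex. On independent sets `ψ` vanishes, so `η` bounds `ω` there.
    obtain ⟨η, hη, h'⟩ := exists_coboundary_eq_of_isCochainOn hW hε h0 (hext.sub hψ.1)
      (by rw [map_sub, h, sub_self])
    refine hne ⟨fun τ => η (Wᶜ ∪ τ), fun τ hτ hi hc => ?_⟩
    rw [← coboundary_compl_union hη ε hτ, h', Pi.sub_apply, hψ.apply_eq_zero hτ hi, sub_zero,
      extendCochain_compl_union ω hτ (by omega)]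
  · obtain ⟨χ, hχ, rfl⟩ := exists_coboundary_eq_of_isCochainOn hW hε h0 hφ.1 hz
    obtain ⟨r, g, hg⟩ := hspan _ (isIndepCocycle_of_isDepCochainOn hχ hφ)
    obtain ⟨ψ, hψ, h⟩ := exists_isDepCochainOn_sub (G := G) hs (g := g)
      (hχ.sub (hext.smul r)) hε fun τ hτ hi hc => by
        rw [Pi.sub_apply, hg τ hτ hi hc, Pi.smul_apply,
          extendCochain_compl_union ω hτ (by omega), smul_eq_mul, add_sub_cancel_left]
    refine ⟨r, ψ, hψ, ?_⟩
    rw [h, map_sub, map_smul, add_sub_cancel]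

end DependenceCochains

/-- The usual signs of the simplicial coboundary. -/
theorem exists_isAlternatingOn_univ (V : Type*) [DecidableEq V] [Fintype V] (K : Type*) [Field K] :
    ∃ ε : Finset V → V → K, IsAlternatingOn Finset.univ ε ∧ ∀ τ v, ε τ v ≠ 0 := by
  let e := Fintype.equivFin V
  refine ⟨fun τ v => (-1) ^ (τ.filter fun u => e u < e v).card, ?_, fun _ _ =>
    pow_ne_zero _ (neg_ne_zero.2 one_ne_zero)⟩
  intro τ u v _ _ _ hu hv huv
  have key : ∀ u v : V, u ∉ τ → ((insert u τ).filter fun x => e x < e v).card =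
      (τ.filter fun x => e x < e v).card + if e u < e v then 1 else 0 := by
    intro u v hu
    rw [Finset.filter_insert]
    split_ifs
    · rw [Finset.card_insert_of_notMem (by simp [hu])]
    · rfl
  simp only [key u v hu, key v u hv]
  rcases (e.injective.ne huv).lt_or_gt with h | h
  · rw [if_pos h, if_neg h.not_gt]
    ring
  · rw [if_pos h, if_neg h.not_gt]
    ring

/-! ### Koszul cochains and their multidegrees -/

section Koszul

open MvPolynomial

variable {V : Type*} {K : Type*} [Field K]

variable (K V) in
/-- The homogeneous component of degree `m` of the polynomial ring. -/
def gradedPart (m : ℤ) : Submodule K (MvPolynomial V K) where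
  carrier := {f | ∀ e, coeff e f ≠ 0 → (e.degree : ℤ) = m}
  add_mem' := by
    intro f g hf hg e he
    by_cases h : coeff e f = 0
    · exact hg e fun h' => he (by rw [coeff_add, h, h', add_zero])
    · exact hf e h
  zero_mem' := fun e he => absurd (coeff_zero e) he
  smul_mem' := fun c f hf e he => hf e fun h => he (by rw [coeff_smul, h, smul_zero])

theorem mem_gradedPart {m : ℤ} {f : MvPolynomial V K} :
    f ∈ gradedPart V K m ↔ ∀ e, coeff e f ≠ 0 → (e.degree : ℤ) = m := Iff.rfl

theorem X_mul_mem_gradedPart {m : ℤ} {f : MvPolynomial V K} (v : V) (hf : f ∈ gradedPart V K m) :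
    X v * f ∈ gradedPart V K (m + 1) := by
  classical
  intro e he
  rw [coeff_X_mul'] at he
  split_ifs at he with hv
  · have := hf _ he
    have h1 : e - Finsupp.single v 1 + Finsupp.single v 1 = e :=
      tsub_add_cancel_of_le (by
        rw [Finsupp.single_le_iff]
        exact Nat.one_le_iff_ne_zero.2 (Finsupp.mem_support_iff.1 hv))
    rw [← h1, map_add, Finsupp.degree_single]
    push_cast
    omega
  · exact absurd rfl he

variable [DecidableEq V]

/-- The weights of the Koszul complex. -/
noncomputable def koszulWeight (ε : Finset V → V → K) (τ : Finset V) (v : V) : MvPolynomial V K :=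
  C (ε τ v) * X v

theorem IsAlternatingOn.koszulWeight {W : Finset V} {ε : Finset V → V → K}
    (hε : IsAlternatingOn W ε) : IsAlternatingOn W (koszulWeight ε) := by
  intro τ u v hτ hu hv huτ hvτ huv
  have := congrArg (C (σ := V)) (hε τ u v hτ hu hv huτ hvτ huv)
  simp only [map_mul, map_neg] at this
  simp only [_root_.koszulWeight]
  linear_combination X u * X v * this

variable [Fintype V]

/-- The exponent of the squarefree monomial with support `σ`. -/
noncomputable def sqfreeExponent (σ : Finset V) : V →₀ ℕ :=
  Finsupp.equivFunOnFinite.symm fun v => if v ∈ σ then 1 else 0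

theorem sqfreeExponent_apply (σ : Finset V) (v : V) :
    sqfreeExponent σ v = if v ∈ σ then 1 else 0 := rfl

theorem degree_sqfreeExponent (σ : Finset V) : (sqfreeExponent σ).degree = σ.card := by
  simp [Finsupp.degree_eq_sum, sqfreeExponent_apply]

theorem sqfreeExponent_le {σ : Finset V} {a : V →₀ ℕ} : sqfreeExponent σ ≤ a ↔ σ ⊆ a.support := by
  constructor
  · intro h v hv
    have := h v
    rw [sqfreeExponent_apply, if_pos hv] at this
    exact Finsupp.mem_support_iff.2 (by omega)
  · intro h v
    rw [sqfreeExponent_apply]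
    split_ifs with hv
    · exact Nat.one_le_iff_ne_zero.2 (Finsupp.mem_support_iff.1 (h hv))
    · exact Nat.zero_le _

theorem sqfreeExponent_insert {σ : Finset V} {v : V} (hv : v ∉ σ) :
    sqfreeExponent (insert v σ) = sqfreeExponent σ + Finsupp.single v 1 := by
  ext w
  rw [Finsupp.add_apply, sqfreeExponent_apply, sqfreeExponent_apply, Finsupp.single_apply]
  by_cases h : w = v
  · subst h
    simp [hv]
  · simp [h, Ne.symm h]

/-- The strand of multidegree `a` of a Koszul cochain. -/
noncomputable def strand (a : V →₀ ℕ) (c : Finset V → MvPolynomial V K) (τ : Finset V) : K :=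
  if τᶜ ⊆ a.support then coeff (a - sqfreeExponent τᶜ) (c τ) else 0

/-- The Koszul cochain concentrated in multidegree `a`. -/
noncomputable def unstrand (a : V →₀ ℕ) (φ : Finset V → K) (τ : Finset V) : MvPolynomial V K :=
  if τᶜ ⊆ a.support then monomial (a - sqfreeExponent τᶜ) (φ τ) else 0

theorem compl_erase_subset {τ S : Finset V} {v : V} :
    (τ.erase v)ᶜ ⊆ S ↔ v ∈ S ∧ τᶜ ⊆ S := by
  rw [Finset.compl_erase, Finset.insert_subset_iff]

theorem sub_sqfreeExponent_erase (a : V →₀ ℕ) {τ : Finset V} {v : V} (hv : v ∈ τ) :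
    a - sqfreeExponent (τ.erase v)ᶜ = a - sqfreeExponent τᶜ - Finsupp.single v 1 := by
  rw [Finset.compl_erase, sqfreeExponent_insert (by simpa using hv), tsub_add_eq_tsub_tsub]

theorem mem_support_sub_sqfreeExponent (a : V →₀ ℕ) {τ : Finset V} {v : V} (hv : v ∈ τ) :
    v ∈ (a - sqfreeExponent τᶜ).support ↔ v ∈ a.support := by
  simp [sqfreeExponent_apply, hv]

/-- Adding `v` to `τ` multiplies by `X v` and takes `v` out of `τᶜ`, so exponent plus indicator of
`τᶜ` is preserved. This sum is the multidegree. -/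
theorem strand_coboundary (ε : Finset V → V → K) (a : V →₀ ℕ)
    (c : Finset V → MvPolynomial V K) :
    strand a (coboundary (koszulWeight ε) c) = coboundary ε (strand a c) := by
  funext τ
  rw [strand]
  split_ifs with h
  · rw [coboundary_apply, coboundary_apply, coeff_sum]
    refine Finset.sum_congr rfl fun v hv => ?_
    rw [koszulWeight, smul_eq_mul, mul_assoc, coeff_C_mul, coeff_X_mul', strand, smul_eq_mul]
    simp only [compl_erase_subset, mem_support_sub_sqfreeExponent a hv,
      sub_sqfreeExponent_erase a hv, h, and_true]
  · refine (coboundary_eq_zero fun v hv => ?_).symm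
    rw [strand, if_neg]
    rw [compl_erase_subset]
    exact fun h' => h h'.2

/-- The support condition is needed: without it the right side would keep contributions from `v`
outside `a.support`, which `unstrand` discards on the left. -/
theorem coboundary_unstrand (ε : Finset V → V → K) {a : V →₀ ℕ} {φ : Finset V → K} {q : ℤ}
    (hφ : IsCochainOn a.support q φ) :
    coboundary (koszulWeight ε) (unstrand a φ) = unstrand a (coboundary ε φ) := by
  funext τ
  rw [unstrand]
  split_ifs with h
  · rw [coboundary_apply, coboundary_apply, map_sum]
    refine Finset.sum_congr rfl fun v hv => ?_
    rw [unstrand]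
    simp only [compl_erase_subset, h, and_true]
    split_ifs with hva
    · have h1 : Finsupp.single v 1 + (a - sqfreeExponent τᶜ - Finsupp.single v 1) =
          a - sqfreeExponent τᶜ := by
        rw [add_comm]
        refine tsub_add_cancel_of_le ?_
        rw [Finsupp.single_le_iff, Nat.one_le_iff_ne_zero, ← Finsupp.mem_support_iff]
        exact (mem_support_sub_sqfreeExponent a hv).2 hva
      rw [sub_sqfreeExponent_erase a hv, koszulWeight, smul_eq_mul, mul_assoc, X, monomial_mul, h1,
        one_mul, C_mul_monomial, smul_eq_mul]
    · have : φ (τ.erase v) = 0 := by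
        by_contra hne
        exact hva ((compl_erase_subset).1 (hφ _ hne).1).1
      simp [this]
  · refine coboundary_eq_zero fun v hv => ?_
    rw [unstrand, if_neg]
    rw [compl_erase_subset]
    exact fun h' => h h'.2

theorem strand_unstrand {a : V →₀ ℕ} {φ : Finset V → K} {q : ℤ}
    (hφ : IsCochainOn a.support q φ) : strand a (unstrand a φ) = φ := by
  funext τ
  rw [strand, unstrand]
  split_ifs with h
  · rw [coeff_monomial, if_pos rfl]
  · by_contra hne
    exact h (hφ τ (Ne.symm hne)).1

theorem coeff_unstrand (a : V →₀ ℕ) (φ : Finset V → K) (τ : Finset V) (e : V →₀ ℕ) :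
    coeff e (unstrand a φ τ) = if a = e + sqfreeExponent τᶜ then φ τ else 0 := by
  rw [unstrand]
  split_ifs with h1 h2 h2
  · rw [coeff_monomial, if_pos]
    rw [h2, add_tsub_cancel_right]
  · rw [coeff_monomial, if_neg]
    rintro rfl
    exact h2 (tsub_add_cancel_of_le (sqfreeExponent_le.2 h1)).symm
  · refine absurd ?_ h1
    rw [← sqfreeExponent_le, h2]
    exact le_add_self
  · simp

theorem strand_add_sqfreeExponent (c : Finset V → MvPolynomial V K) (e : V →₀ ℕ) (τ : Finset V) :
    strand (e + sqfreeExponent τᶜ) c τ = coeff e (c τ) := by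
  rw [strand, if_pos, add_tsub_cancel_right]
  rw [← sqfreeExponent_le]
  exact le_add_self

/-- The multidegrees occurring in a Koszul cochain. -/
noncomputable def multidegrees (c : Finset V → MvPolynomial V K) : Finset (V →₀ ℕ) :=
  Finset.univ.biUnion fun τ => (c τ).support.image fun e => e + sqfreeExponent τᶜ

theorem sum_unstrand_strand (c : Finset V → MvPolynomial V K) :
    ∑ a ∈ multidegrees c, unstrand a (strand a c) = c := by
  funext τ
  ext e
  rw [Finset.sum_apply, coeff_sum]
  simp only [coeff_unstrand]
  rw [Finset.sum_ite_eq', strand_add_sqfreeExponent]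
  split_ifs with h
  · rfl
  · by_contra hne
    refine h (Finset.mem_biUnion.2 ⟨τ, Finset.mem_univ _, Finset.mem_image.2 ⟨e, ?_, rfl⟩⟩)
    exact mem_support_iff.2 (Ne.symm hne)

end Koszul

/-! ### Graded Koszul cohomology of a submodule -/

section Cochains

variable {V : Type*} {K : Type*} [Field K] {M : Type*} [AddCommGroup M]
  [Module (MvPolynomial V K) M] [Module K M] [IsScalarTower K (MvPolynomial V K) M]

/-- The homogeneous Koszul cochains with values in the submodule `Z` of a graded module. -/
def koszulCochains (gM : ℤ → Submodule K M) (Z : Submodule (MvPolynomial V K) M) (D q : ℤ) :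
    Submodule K (Finset V → M) where
  carrier := {c | ∀ τ, c τ ∈ Z ∧ c τ ∈ gM (D + q) ∧ ((τ.card : ℤ) ≠ q → c τ = 0)}
  add_mem' := fun {c c'} h h' τ => ⟨Z.add_mem (h τ).1 (h' τ).1,
    Submodule.add_mem _ (h τ).2.1 (h' τ).2.1, fun hτ => by
      rw [Pi.add_apply, (h τ).2.2 hτ, (h' τ).2.2 hτ, add_zero]⟩
  zero_mem' := fun τ => ⟨Z.zero_mem, Submodule.zero_mem _, fun _ => rfl⟩
  smul_mem' := fun r c h τ => ⟨Z.smul_of_tower_mem r (h τ).1,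
    Submodule.smul_mem _ _ (h τ).2.1, fun hτ => by rw [Pi.smul_apply, (h τ).2.2 hτ, smul_zero]⟩

variable [DecidableEq V]

/-- The Koszul differential as a linear map over the ground field. -/
noncomputable def koszulDifferential (ε : Finset V → V → K) : (Finset V → M) →ₗ[K] (Finset V → M) :=
  (coboundary (koszulWeight ε)).restrictScalars K

theorem koszulDifferential_apply (ε : Finset V → V → K) (c : Finset V → M) :
    koszulDifferential ε c = coboundary (koszulWeight ε) c := rfl

theorem koszulDifferential_mem {gM : ℤ → Submodule K M}
    (hX : ∀ (v : V) m, ∀ x ∈ gM m, (MvPolynomial.X v : MvPolynomial V K) • x ∈ gM (m + 1))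
    {Z : Submodule (MvPolynomial V K) M} {D q : ℤ} (ε : Finset V → V → K)
    {c : Finset V → M} (hc : c ∈ koszulCochains gM Z D (q - 1)) :
    koszulDifferential ε c ∈ koszulCochains gM Z D q := by
  intro τ
  rw [koszulDifferential_apply]
  refine ⟨Submodule.sum_mem _ fun v _ => Z.smul_mem _ (hc _).1, Submodule.sum_mem _ fun v _ => ?_,
    fun hτ => coboundary_eq_zero fun v hv => (hc _).2.2 ?_⟩
  · have := hX v _ _ (hc (τ.erase v)).2.1
    rw [show D + (q - 1) + 1 = D + q by ring] at this
    rw [koszulWeight, mul_smul, ← MvPolynomial.algebraMap_eq, algebraMap_smul]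
    exact Submodule.smul_mem _ _ this
  · have := Finset.card_erase_add_one hv
    omega

theorem koszulDifferential_koszulDifferential [Fintype V] {ε : Finset V → V → K}
    (hε : IsAlternatingOn Finset.univ ε) (c : Finset V → M) :
    koszulDifferential ε (koszulDifferential ε c) = 0 :=
  funext fun _ => coboundary_coboundary hε.koszulWeight c (Finset.subset_univ _)

/-- The Koszul cocycles. -/
noncomputable def koszulCocycles (ε : Finset V → V → K) (gM : ℤ → Submodule K M)
    (Z : Submodule (MvPolynomial V K) M) (D q : ℤ) : Submodule K (Finset V → M) :=
  koszulCochains gM Z D q ⊓ LinearMap.ker (koszulDifferential ε)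

/-- The Koszul coboundaries. -/
noncomputable def koszulCoboundaries (ε : Finset V → V → K) (gM : ℤ → Submodule K M)
    (Z : Submodule (MvPolynomial V K) M) (D q : ℤ) : Submodule K (Finset V → M) :=
  (koszulCochains gM Z D (q - 1)).map (koszulDifferential ε)

/-- The dimension of the Koszul cohomology. -/
noncomputable def koszulRank (ε : Finset V → V → K) (gM : ℤ → Submodule K M)
    (Z : Submodule (MvPolynomial V K) M) (D q : ℤ) : ℕ :=
  Module.finrank K
    (koszulCocycles ε gM Z D q ⧸ (koszulCoboundaries ε gM Z D q).submoduleOf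
      (koszulCocycles ε gM Z D q))

end Cochains

/-! ### Multigraded strands of monomial submodules -/

section Strands

open MvPolynomial

variable {V : Type*} [DecidableEq V] [Fintype V] {K : Type*} [Field K]

/-- `Z` is spanned over `K` by the monomials with exponents in `U`. -/
def IsMonomialWith (U : Set (V →₀ ℕ)) (Z : Submodule (MvPolynomial V K) (MvPolynomial V K)) : Prop :=
  ∀ f, f ∈ Z ↔ ∀ e, coeff e f ≠ 0 → e ∈ U

/-- Cochains in multidegree `a` of the module spanned by the monomials with exponents in `U`. -/
def IsStrandOf (U : Set (V →₀ ℕ)) (a : V →₀ ℕ) (q : ℤ) (φ : Finset V → K) : Prop :=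
  IsCochainOn a.support q φ ∧ ∀ τ, φ τ ≠ 0 → a - sqfreeExponent τᶜ ∈ U

variable {U : Set (V →₀ ℕ)} {Z : Submodule (MvPolynomial V K) (MvPolynomial V K)}
  {ε : Finset V → V → K} {D q : ℤ}

theorem coeff_ne_zero_of_strand_ne_zero {a : V →₀ ℕ} {c : Finset V → MvPolynomial V K}
    {τ : Finset V} (h : strand a c τ ≠ 0) :
    τᶜ ⊆ a.support ∧ coeff (a - sqfreeExponent τᶜ) (c τ) ≠ 0 := by
  rw [strand] at h
  split_ifs at h with h1
  · exact ⟨h1, h⟩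
  · exact absurd rfl h

theorem isStrandOf_strand (hZ : IsMonomialWith U Z) {c : Finset V → MvPolynomial V K}
    (hc : c ∈ koszulCochains (gradedPart V K) Z D q) (a : V →₀ ℕ) :
    IsStrandOf U a q (strand a c) := by
  refine ⟨fun τ hτ => ⟨(coeff_ne_zero_of_strand_ne_zero hτ).1, ?_⟩, fun τ hτ =>
    (hZ _).1 (hc τ).1 _ (coeff_ne_zero_of_strand_ne_zero hτ).2⟩
  by_contra hne
  have h1 := (coeff_ne_zero_of_strand_ne_zero hτ).2
  rw [(hc τ).2.2 hne, coeff_zero] at h1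
  exact h1 rfl

theorem degree_sub_sqfreeExponent {a : V →₀ ℕ} {τ : Finset V} (h : τᶜ ⊆ a.support) :
    ((a - sqfreeExponent τᶜ).degree : ℤ) = a.degree + τ.card - Fintype.card V := by
  have h1 := congrArg Finsupp.degree (tsub_add_cancel_of_le (sqfreeExponent_le.2 h))
  rw [map_add, degree_sqfreeExponent, Finset.card_compl] at h1
  have := Finset.card_le_univ τ
  omega

/-- At a set of size `q` the polynomial has degree `D + q` and the complement contributes `|V| - q`;
the index `D` thus fixes the total degree. -/
theorem degree_eq_of_strand_ne_zero {c : Finset V → MvPolynomial V K}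
    (hc : c ∈ koszulCochains (gradedPart V K) Z D q) {a : V →₀ ℕ} (h : strand a c ≠ 0) :
    (a.degree : ℤ) = D + Fintype.card V := by
  obtain ⟨τ, hτ⟩ := Function.ne_iff.1 h
  obtain ⟨h1, h2⟩ := coeff_ne_zero_of_strand_ne_zero hτ
  have h3 := (hc τ).2.1 _ h2
  rw [degree_sub_sqfreeExponent h1] at h3
  have h4 : (τ.card : ℤ) = q := by
    by_contra hne
    rw [(hc τ).2.2 hne, coeff_zero] at h2
    exact h2 rfl
  omega

theorem unstrand_mem (hZ : IsMonomialWith U Z) {a : V →₀ ℕ} (ha : (a.degree : ℤ) = D + Fintype.card V)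
    {φ : Finset V → K} (hφ : IsStrandOf U a q φ) :
    unstrand a φ ∈ koszulCochains (gradedPart V K) Z D q := by
  intro τ
  by_cases h0 : φ τ = 0
  · have : unstrand a φ τ = 0 := by
      rw [unstrand, h0]
      simp
    rw [this]
    exact ⟨Z.zero_mem, Submodule.zero_mem _, fun _ => rfl⟩
  · obtain ⟨h1, h2⟩ := hφ.1 τ h0
    have hcoeff : ∀ e, coeff e (unstrand a φ τ) ≠ 0 → e = a - sqfreeExponent τᶜ := by
      intro e he
      rw [unstrand, if_pos h1, coeff_monomial] at he
      by_contra hne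
      exact he (if_neg (Ne.symm hne))
    refine ⟨(hZ _).2 fun e he => ?_, fun e he => ?_, fun h => absurd h2 h⟩
    · rw [hcoeff e he]
      exact hφ.2 τ h0
    · rw [hcoeff e he, degree_sub_sqfreeExponent h1]
      omega

/-- A Koszul cocycle all of whose strands are coboundaries is a coboundary. -/
theorem mem_koszulCoboundaries_of_strand (hZ : IsMonomialWith U Z) {c : Finset V → MvPolynomial V K}
    (hc : c ∈ koszulCocycles ε (gradedPart V K) Z D q)
    (h : ∀ a : V →₀ ℕ, (a.degree : ℤ) = D + Fintype.card V →
      ∃ ψ, IsStrandOf U a (q - 1) ψ ∧ coboundary ε ψ = strand a c) :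
    c ∈ koszulCoboundaries ε (gradedPart V K) Z D q := by
  rw [← sum_unstrand_strand c]
  refine Submodule.sum_mem _ fun a _ => ?_
  by_cases h0 : strand a c = 0
  · have : unstrand a (strand a c) = 0 := by
      rw [h0]
      funext τ
      simp [unstrand]
    rw [this]
    exact Submodule.zero_mem _
  · have ha := degree_eq_of_strand_ne_zero hc.1 h0
    obtain ⟨ψ, hψ, hψc⟩ := h a ha
    refine ⟨unstrand a ψ, unstrand_mem hZ ha hψ, ?_⟩
    rw [koszulDifferential_apply, coboundary_unstrand ε hψ.1, hψc]

theorem coboundary_strand_eq_zero {c : Finset V → MvPolynomial V K}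
    (hc : c ∈ koszulCocycles ε (gradedPart V K) Z D q) (a : V →₀ ℕ) :
    coboundary ε (strand a c) = 0 := by
  have : coboundary (koszulWeight ε) c = 0 := hc.2
  rw [← strand_coboundary, this]
  funext τ
  simp [strand]

/-- A strand is exact if membership in `U` does not depend on the exponent of some variable. -/
theorem IsStrandOf.exists_of_forall (hε : IsAlternatingOn Finset.univ ε) (h0 : ∀ τ v, ε τ v ≠ 0)
    {a : V →₀ ℕ} {v : V} (hv : v ∈ a.support)
    (hU : ∀ e : V →₀ ℕ, e v + 1 = a v → e + Finsupp.single v 1 ∈ U → e ∈ U)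
    {φ : Finset V → K} (hφ : IsStrandOf U a q φ) (hz : coboundary ε φ = 0) :
    ∃ ψ, IsStrandOf U a (q - 1) ψ ∧ coboundary ε ψ = φ := by
  refine ⟨contractCone ε v φ, ⟨hφ.1.contractCone ε hv, fun τ hτ => ?_⟩, funext fun τ =>
    coboundary_contractCone hε h0 (Finset.mem_univ v) φ (Finset.subset_univ _)
      fun _ => congrFun hz _⟩
  rw [contractCone] at hτ
  split_ifs at hτ with hvτ
  · exact absurd rfl hτ
  have h1 := hφ.2 _ (right_ne_zero_of_mul hτ)
  have hav : a v ≠ 0 := Finsupp.mem_support_iff.1 hv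
  have h2 : sqfreeExponent τᶜ v = 1 := by simp [sqfreeExponent_apply, hvτ]
  refine hU _ ?_ ?_
  · rw [Finsupp.tsub_apply, h2]
    omega
  · convert h1 using 1
    have h3 : τᶜ = insert v (insert v τ)ᶜ := by
      ext x
      by_cases hx : x = v
      · simp [hx, hvτ]
      · simp [hx]
    rw [h3, sqfreeExponent_insert (by simp)]
    ext x
    simp only [Finsupp.add_apply, Finsupp.tsub_apply, Finsupp.single_apply, sqfreeExponent_apply]
    by_cases hx : v = x
    · subst hx
      simp
      omega
    · simp [hx]

end Strands

/-! ### Hochster's formula for edge ideals -/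

section EdgeIdeal

open MvPolynomial

variable {V : Type*} {K : Type*} [Field K] {G : SimpleGraph V}

/-- The exponents of the monomials in the edge ideal of `G`. -/
def edgeExponents (G : SimpleGraph V) : Set (V →₀ ℕ) :=
  {e | ∃ u v, G.Adj u v ∧ e u ≠ 0 ∧ e v ≠ 0}

theorem mem_edgeIdeal_iff {f : MvPolynomial V K} :
    f ∈ edgeIdeal K G ↔ ∀ e, coeff e f ≠ 0 → e ∈ edgeExponents G := by
  classical
  have h1 : {f : MvPolynomial V K | ∃ u v : V, G.Adj u v ∧ f = X u * X v} =
      (fun s => monomial s (1 : K)) ''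
        {s | ∃ u v, G.Adj u v ∧ s = Finsupp.single u 1 + Finsupp.single v 1} := by
    ext f
    constructor
    · rintro ⟨u, v, h, rfl⟩
      exact ⟨_, ⟨u, v, h, rfl⟩, by simp [X, monomial_mul]⟩
    · rintro ⟨_, ⟨u, v, h, rfl⟩, rfl⟩
      exact ⟨u, v, h, by simp [X, monomial_mul]⟩
  rw [edgeIdeal, h1, mem_ideal_span_monomial_image]
  simp only [mem_support_iff]
  refine forall_congr' fun e => imp_congr_right fun _ => ?_
  constructor
  · rintro ⟨_, ⟨u, v, h, rfl⟩, hle⟩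
    have h1 := hle u
    have h2 := hle v
    simp [Finsupp.single_apply] at h1 h2
    exact ⟨u, v, h, by omega, by omega⟩
  · rintro ⟨u, v, h, hu, hv⟩
    refine ⟨_, ⟨u, v, h, rfl⟩, fun x => ?_⟩
    have := h.ne
    simp only [Finsupp.add_apply, Finsupp.single_apply]
    split_ifs with h1 h2 h2
    · exact absurd (h1.trans h2.symm) this
    · subst h1
      omega
    · subst h2
      omega
    · omega

theorem isMonomialWith_edgeIdeal : IsMonomialWith (edgeExponents G) (edgeIdeal K G) :=
  fun _ => mem_edgeIdeal_iff

variable [DecidableEq V] [Fintype V]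

theorem eq_sqfreeExponent_support {a : V →₀ ℕ} (ha : ∀ v, a v ≤ 1) :
    a = sqfreeExponent a.support := by
  ext v
  have := ha v
  rw [sqfreeExponent_apply]
  split_ifs with h <;> rw [Finsupp.mem_support_iff] at h <;> omega

/-- For squarefree `a` the remaining monomial is the product of the variables in `τ ∩ a.support`,
and it lies in the ideal exactly when this set contains an edge. -/
theorem sub_mem_edgeExponents_iff {a : V →₀ ℕ} (ha : ∀ v, a v ≤ 1) {τ : Finset V} :
    a - sqfreeExponent τᶜ ∈ edgeExponents G ↔
      ¬ G.IsIndepSet ((τ ∩ a.support : Finset V) : Set V) := by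
  have key : ∀ v, (a - sqfreeExponent τᶜ) v ≠ 0 ↔ v ∈ τ ∩ a.support := by
    intro v
    have := ha v
    rw [Finsupp.tsub_apply, sqfreeExponent_apply, Finset.mem_inter, Finsupp.mem_support_iff]
    by_cases h : v ∈ τ <;> simp [h, this]
  rw [SimpleGraph.isIndepSet_iff, Set.Pairwise]
  push Not
  constructor
  · rintro ⟨u, v, h, hu, hv⟩
    exact ⟨u, (key u).1 hu, v, (key v).1 hv, h.ne, h⟩
  · rintro ⟨u, hu, v, hv, -, h⟩
    exact ⟨u, v, h, (key u).2 hu, (key v).2 hv⟩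

theorem isStrandOf_edgeExponents_iff {a : V →₀ ℕ} (ha : ∀ v, a v ≤ 1) {q : ℤ} {φ : Finset V → K} :
    IsStrandOf (edgeExponents G) a q φ ↔ IsDepCochainOn G a.support q φ :=
  and_congr_right fun _ => forall_congr' fun _ => imp_congr_right fun _ =>
    sub_mem_edgeExponents_iff ha

theorem degree_eq_card_support {a : V →₀ ℕ} (ha : ∀ v, a v ≤ 1) : a.degree = a.support.card := by
  conv_lhs => rw [eq_sqfreeExponent_support ha]
  rw [degree_sqfreeExponent]

/-- Squarefree strands are relative cochains of the independence complex on `a.support`; a strand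
with some `a v ≥ 2` is contracted along `v`. -/
theorem exists_coboundary_eq_strand {ε : Finset V → V → K} (hε : IsAlternatingOn Finset.univ ε)
    (h0 : ∀ τ v, ε τ v ≠ 0) {D q : ℤ} {a : V →₀ ℕ} (ha : (a.degree : ℤ) = D + Fintype.card V)
    (h : (∀ v, a v ≤ 1) → IndepAcyclic K G a.support (D + q - 1)) {φ : Finset V → K}
    (hφ : IsStrandOf (edgeExponents G) a q φ) (hz : coboundary ε φ = 0) :
    ∃ ψ, IsStrandOf (edgeExponents G) a (q - 1) ψ ∧ coboundary ε ψ = φ := by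
  by_cases hsq : ∀ v, a v ≤ 1
  · rcases a.support.eq_empty_or_nonempty with hem | hne
    · refine ⟨0, ⟨fun _ h => absurd rfl h, fun _ h => absurd rfl h⟩, ?_⟩
      rw [map_zero]
      funext τ
      by_contra hτ
      obtain ⟨u, v, -, hu, -⟩ := hφ.2 τ (Ne.symm hτ)
      rw [Finsupp.support_eq_empty.1 hem] at hu
      simp at hu
    · rw [degree_eq_card_support hsq] at ha
      simp only [isStrandOf_edgeExponents_iff hsq] at hφ ⊢
      exact (h hsq).exists_coboundary_eq hne (by omega) hε h0 hφ hz
  · push Not at hsq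
    -- Dividing by `X v` when its exponent is at least 2 leaves the support unchanged, and
    -- membership in the edge ideal depends only on the support.
    obtain ⟨v, hv⟩ := hsq
    refine hφ.exists_of_forall hε h0 (v := v) (Finsupp.mem_support_iff.2 (by omega)) ?_ hz
    rintro e he ⟨x, y, hxy, hx, hy⟩
    refine ⟨x, y, hxy, ?_, ?_⟩
    · by_cases h : v = x
      · subst h
        omega
      · simpa [Finsupp.single_apply, h] using hx
    · by_cases h : v = y
      · subst h
        omega
      · simpa [Finsupp.single_apply, h] using hy

theorem koszulRank_edgeIdeal_eq_zero {ε : Finset V → V → K} (hε : IsAlternatingOn Finset.univ ε)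
    (h0 : ∀ τ v, ε τ v ≠ 0) {D q : ℤ}
    (h : ∀ W : Finset V, (W.card : ℤ) = D + Fintype.card V → IndepAcyclic K G W (D + q - 1)) :
    koszulRank ε (gradedPart V K) (edgeIdeal K G) D q = 0 := by
  rw [koszulRank]
  have : (koszulCoboundaries ε (gradedPart V K) (edgeIdeal K G) D q).submoduleOf
      (koszulCocycles ε (gradedPart V K) (edgeIdeal K G) D q) = ⊤ := by
    rw [Submodule.submoduleOf_eq_top]
    intro c hc
    refine mem_koszulCoboundaries_of_strand isMonomialWith_edgeIdeal hc fun a ha =>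
      exists_coboundary_eq_strand hε h0 ha (fun hsq => h _ ?_)
        (isStrandOf_strand isMonomialWith_edgeIdeal hc.1 a) (coboundary_strand_eq_zero hc a)
    rw [← ha, degree_eq_card_support hsq]
  rw [this]
  have : Subsingleton (koszulCocycles ε (gradedPart V K) (edgeIdeal K G) D q ⧸
    (⊤ : Submodule K (koszulCocycles ε (gradedPart V K) (edgeIdeal K G) D q))) :=
      Submodule.Quotient.subsingleton_iff.2 rfl
  exact Module.finrank_zero_of_subsingleton

/-- `D = 0` means total degree `|V|`, where the only squarefree multidegree is the all-ones vector.
The whole cohomology therefore comes from the full vertex set. -/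
theorem koszulRank_edgeIdeal_eq_one [Nonempty V] {ε : Finset V → V → K}
    (hε : IsAlternatingOn Finset.univ ε) (h0 : ∀ τ v, ε τ v ≠ 0) {q : ℤ}
    (h : IndepLine K G Finset.univ (q - 1)) :
    koszulRank ε (gradedPart V K) (edgeIdeal K G) 0 q = 1 := by
  have hZ := isMonomialWith_edgeIdeal (K := K) (G := G)
  set a : V →₀ ℕ := sqfreeExponent Finset.univ with ha
  have ha1 : ∀ v, a v = 1 := fun v => by simp [ha, sqfreeExponent_apply]
  have hsq : ∀ v, a v ≤ 1 := fun v => (ha1 v).le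
  have hsupp : a.support = Finset.univ := by
    ext v
    simp [ha1]
  have hdeg : (a.degree : ℤ) = 0 + Fintype.card V := by
    rw [ha, degree_sqfreeExponent, Finset.card_univ, zero_add]
  have huniq : ∀ b : V →₀ ℕ, (b.degree : ℤ) = 0 + Fintype.card V → (∀ v, b v ≤ 1) → b = a := by
    intro b hb hb1
    rw [degree_eq_card_support hb1, zero_add, Nat.cast_inj, Finset.card_eq_iff_eq_univ] at hb
    rw [eq_sqfreeExponent_support hb1, hb]
  obtain ⟨ω, hω, hzω, hne, hspan⟩ := h.exists_coboundary_eq Finset.univ_nonempty (q := q)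
    (by rw [Finset.card_univ]; ring) hε h0
  simp only [← hsupp] at hω hne hspan
  simp only [← isStrandOf_edgeExponents_iff hsq] at hω hne hspan
  have hωZ : unstrand a ω ∈ koszulCocycles ε (gradedPart V K) (edgeIdeal K G) 0 q := by
    refine ⟨unstrand_mem hZ hdeg hω, ?_⟩
    change koszulDifferential ε (unstrand a ω) = 0
    rw [koszulDifferential_apply, coboundary_unstrand ε hω.1, hzω]
    funext τ
    simp [unstrand]
  rw [koszulRank]
  refine (finrank_eq_one_iff_of_nonzero' (Submodule.Quotient.mk ⟨unstrand a ω, hωZ⟩) ?_).2 ?_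
  · rw [Ne, Submodule.Quotient.mk_eq_zero]
    rintro ⟨y, hy, h⟩
    refine hne ⟨strand a y, isStrandOf_strand hZ hy a, ?_⟩
    rw [← strand_coboundary, ← koszulDifferential_apply, h]
    exact strand_unstrand hω.1
  · intro x
    obtain ⟨⟨c, hc⟩, rfl⟩ := Submodule.Quotient.mk_surjective _ x
    obtain ⟨r, ψ, hψ, hr⟩ := hspan _ (isStrandOf_strand hZ hc.1 a) (coboundary_strand_eq_zero hc a)
    refine ⟨r, ?_⟩
    rw [eq_comm, ← Submodule.Quotient.mk_smul, Submodule.Quotient.eq]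
    change c - r • unstrand a ω ∈ koszulCoboundaries ε (gradedPart V K) (edgeIdeal K G) 0 q
    have hmem : c - r • unstrand a ω ∈ koszulCocycles ε (gradedPart V K) (edgeIdeal K G) 0 q :=
      Submodule.sub_mem _ hc (Submodule.smul_mem _ _ hωZ)
    refine mem_koszulCoboundaries_of_strand hZ hmem fun b hb => ?_
    by_cases hba : b = a
    · subst hba
      refine ⟨ψ, hψ, ?_⟩
      have h1 : strand a (c - r • unstrand a ω) = strand a c - r • strand a (unstrand a ω) := by
        funext τ
        simp only [strand, Pi.sub_apply, Pi.smul_apply, coeff_sub, coeff_smul]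
        split_ifs <;> simp
      rw [h1, strand_unstrand hω.1, hr, add_sub_cancel_left]
    · exact exists_coboundary_eq_strand hε h0 hb (fun hb1 => absurd (huniq b hb hb1) hba)
        (isStrandOf_strand hZ hmem.1 b) (coboundary_strand_eq_zero hmem b)

end EdgeIdeal

/-! ### Exactness of the Koszul complex of a free module -/

section FreeModules

open MvPolynomial

variable {V : Type*} {K : Type*} [Field K] {r : ℕ}

variable (V K) in
/-- The homogeneous component of degree `m` of the free module `⊕ₐ R(-dₐ)`. -/
noncomputable def gradedVector (d : Fin r → ℕ) (m : ℤ) : Submodule K (Fin r → MvPolynomial V K) :=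
  Submodule.pi Set.univ fun a => gradedPart V K (m - d a)

theorem mem_gradedVector {d : Fin r → ℕ} {m : ℤ} {f : Fin r → MvPolynomial V K} :
    f ∈ gradedVector V K d m ↔ ∀ a, f a ∈ gradedPart V K (m - d a) := by
  simp [gradedVector, Submodule.mem_pi]

theorem X_smul_mem_gradedVector {d : Fin r → ℕ} (v : V) (m : ℤ) (f : Fin r → MvPolynomial V K)
    (hf : f ∈ gradedVector V K d m) :
    (X v : MvPolynomial V K) • f ∈ gradedVector V K d (m + 1) := by
  rw [mem_gradedVector] at hf ⊢
  intro a
  have := X_mul_mem_gradedPart v (hf a)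
  rwa [show m - d a + 1 = m + 1 - d a by ring] at this

theorem constantCoeff_eq_zero_of_mem_gradedPart {m : ℤ} (hm : m ≠ 0) {f : MvPolynomial V K}
    (hf : f ∈ gradedPart V K m) : constantCoeff f = 0 := by
  by_contra h
  exact hm (by simpa using (hf 0 h).symm)

variable [DecidableEq V] [Fintype V] {ε : Finset V → V → K}

/-- The Koszul complex of the polynomial ring is exact up to the residue field. -/
theorem exists_koszulDifferential_eq_of_ring (hε : IsAlternatingOn Finset.univ ε)
    (h0 : ∀ τ v, ε τ v ≠ 0) {D q : ℤ} {c : Finset V → MvPolynomial V K}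
    (hc : c ∈ koszulCochains (gradedPart V K) ⊤ D q) (hz : koszulDifferential ε c = 0)
    (hconst : constantCoeff (c Finset.univ) = 0) :
    ∃ y ∈ koszulCochains (gradedPart V K) ⊤ D (q - 1), koszulDifferential ε y = c := by
  have hU : IsMonomialWith (K := K) (V := V) Set.univ ⊤ := fun f => by simp
  have hcz : c ∈ koszulCocycles ε (gradedPart V K) ⊤ D q := ⟨hc, hz⟩
  refine mem_koszulCoboundaries_of_strand hU hcz fun a _ => ?_
  -- Any variable in the support gives a contraction. In multidegree 0 only the constant term at
  -- `Finset.univ` could survive, and it vanishes by hypothesis.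
  rcases a.support.eq_empty_or_nonempty with hem | ⟨v, hv⟩
  · refine ⟨0, ⟨fun _ h => absurd rfl h, fun _ h => absurd rfl h⟩, ?_⟩
    rw [map_zero]
    funext τ
    by_contra hne
    obtain ⟨h1, h2⟩ := coeff_ne_zero_of_strand_ne_zero (Ne.symm hne)
    rw [hem, Finset.subset_empty, Finset.compl_eq_empty_iff] at h1
    rw [Finsupp.support_eq_empty.1 hem, zero_tsub, h1] at h2
    exact h2 hconst
  · exact (isStrandOf_strand hU hc a).exists_of_forall hε h0 hv (fun _ _ _ => Set.mem_univ _)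
      (coboundary_strand_eq_zero hcz a)

theorem exists_koszulDifferential_eq (hε : IsAlternatingOn Finset.univ ε)
    (h0 : ∀ τ v, ε τ v ≠ 0) {d : Fin r → ℕ} {D q : ℤ} {c : Finset V → Fin r → MvPolynomial V K}
    (hc : c ∈ koszulCochains (gradedVector V K d) ⊤ D q) (hz : koszulDifferential ε c = 0)
    (hconst : ∀ a, constantCoeff (c Finset.univ a) = 0) :
    ∃ y ∈ koszulCochains (gradedVector V K d) ⊤ D (q - 1), koszulDifferential ε y = c := by
  have h : ∀ a, ∃ y ∈ koszulCochains (gradedPart V K) ⊤ (D - d a) (q - 1),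
      koszulDifferential ε y = fun τ => c τ a := by
    intro a
    refine exists_koszulDifferential_eq_of_ring hε h0 (fun τ => ⟨trivial, ?_, fun hτ => ?_⟩) ?_
      (hconst a)
    · have := mem_gradedVector.1 (hc τ).2.1 a
      rwa [show D - d a + q = D + q - d a by ring]
    · rw [(hc τ).2.2 hτ, Pi.zero_apply]
    · funext τ
      rw [koszulDifferential_apply,
        show (fun τ => c τ a) = fun τ => (LinearMap.proj a : (Fin r → MvPolynomial V K)
          →ₗ[MvPolynomial V K] MvPolynomial V K) (c τ) from rfl, coboundary_comp_linearMap,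
        ← koszulDifferential_apply, hz]
      rfl
  choose y hy hyc using h
  refine ⟨fun τ a => y a τ, fun τ => ⟨trivial, mem_gradedVector.2 fun a => ?_, fun hτ => ?_⟩, ?_⟩
  · have := (hy a τ).2.1
    rwa [show D - d a + (q - 1) = D + (q - 1) - d a by ring] at this
  · funext a
    exact (hy a τ).2.2 hτ
  · funext τ a
    have := coboundary_comp_linearMap (koszulWeight ε) (LinearMap.proj a :
      (Fin r → MvPolynomial V K) →ₗ[MvPolynomial V K] MvPolynomial V K) (fun τ a => y a τ) τ
    rw [koszulDifferential_apply]
    exact this.symm.trans (congrFun (hyc a) τ)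

end FreeModules

/-! ### Dimension shifting and counting of generators -/

section Shift

theorem finrank_quotient_submoduleOf_map {K E A : Type*} [Field K] [AddCommGroup E] [Module K E]
    [AddCommGroup A] [Module K A] (Y : Submodule K E) (α : E →ₗ[K] A) (B : Submodule K A) :
    Module.finrank K (Y.map α ⧸ B.submoduleOf (Y.map α)) =
      Module.finrank K (Y ⧸ (B.comap α).submoduleOf Y) := by
  let g : Y →ₗ[K] Y.map α := α.restrict fun y hy => Submodule.mem_map_of_mem hy
  have hg : Function.Surjective ((B.submoduleOf (Y.map α)).mkQ ∘ₗ g) := by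
    refine (Submodule.mkQ_surjective _).comp ?_
    rintro ⟨_, y, hy, rfl⟩
    exact ⟨⟨y, hy⟩, rfl⟩
  have hk : LinearMap.ker ((B.submoduleOf (Y.map α)).mkQ ∘ₗ g) = (B.comap α).submoduleOf Y := by
    rw [LinearMap.ker_comp, Submodule.ker_mkQ]
    rfl
  rw [← hk]
  exact (LinearMap.quotKerEquivOfSurjective _ hg).finrank_eq.symm

/-- Two quotients are compared through a common source mapping onto both numerators. This replaces a
connecting homomorphism, which would require choices of lifts. -/
theorem finrank_quotient_eq_of_map {K E A B : Type*} [Field K] [AddCommGroup E] [Module K E]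
    [AddCommGroup A] [Module K A] [AddCommGroup B] [Module K B] (Y : Submodule K E)
    (α : E →ₗ[K] A) (β : E →ₗ[K] B) {ZA BA : Submodule K A} {ZB BB : Submodule K B}
    (hα : Y.map α = ZA) (hβ : Y.map β = ZB) (h : ∀ y ∈ Y, α y ∈ BA ↔ β y ∈ BB) :
    Module.finrank K (ZA ⧸ BA.submoduleOf ZA) = Module.finrank K (ZB ⧸ BB.submoduleOf ZB) := by
  subst hα hβ
  rw [finrank_quotient_submoduleOf_map, finrank_quotient_submoduleOf_map]
  have : (BA.comap α).submoduleOf Y = (BB.comap β).submoduleOf Y := by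
    ext ⟨y, hy⟩
    exact h y hy
  rw [this]

open MvPolynomial

variable {V : Type*} {K : Type*} [Field K] {r : ℕ} {M : Type*} [AddCommGroup M] [Module (MvPolynomial V K) M] [Module K M]
  [IsScalarTower K (MvPolynomial V K) M] {gM : ℤ → Submodule K M} {d : Fin r → ℕ}
  {π : (Fin r → MvPolynomial V K) →ₗ[MvPolynomial V K] M}

/-- Postcomposition of cochains with a linear map. -/
noncomputable def mapCochain (π : (Fin r → MvPolynomial V K) →ₗ[MvPolynomial V K] M) :
    (Finset V → Fin r → MvPolynomial V K) →ₗ[K] (Finset V → M) where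
  toFun y τ := π (y τ)
  map_add' y z := by
    funext τ
    simp
  map_smul' c y := by
    funext τ
    simp [π.map_smul_of_tower]

theorem mapCochain_mem (hπ : ∀ m, ∀ f ∈ gradedVector V K d m, π f ∈ gM m) {D q : ℤ}
    {y : Finset V → Fin r → MvPolynomial V K}
    (hy : y ∈ koszulCochains (gradedVector V K d) ⊤ D q) :
    mapCochain π y ∈ koszulCochains gM (LinearMap.range π) D q :=
  fun τ => ⟨LinearMap.mem_range_self π _, hπ _ _ (hy τ).2.1, fun hτ => by
    change π (y τ) = 0
    rw [(hy τ).2.2 hτ, map_zero]⟩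

theorem exists_mapCochain_eq
    (hlift : ∀ m, ∀ z ∈ LinearMap.range π, z ∈ gM m → ∃ f ∈ gradedVector V K d m, π f = z)
    {D q : ℤ} {z : Finset V → M} (hz : z ∈ koszulCochains gM (LinearMap.range π) D q) :
    ∃ y ∈ koszulCochains (gradedVector V K d) ⊤ D q, mapCochain π y = z := by
  choose f hf hfz using fun τ => hlift _ (z τ) (hz τ).1 (hz τ).2.1
  refine ⟨fun τ => if (τ.card : ℤ) = q then f τ else 0, fun τ => ⟨trivial, ?_, fun h => if_neg h⟩,
    funext fun τ => ?_⟩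
  · dsimp only
    split_ifs
    · exact hf τ
    · exact Submodule.zero_mem _
  · change π (if _ then _ else _) = _
    split_ifs with h
    · exact hfz τ
    · rw [map_zero, (hz τ).2.2 h]

theorem mem_ker_of_mapCochain_eq_zero {D q : ℤ} {y : Finset V → Fin r → MvPolynomial V K}
    (hy : y ∈ koszulCochains (gradedVector V K d) ⊤ D q) (h : mapCochain π y = 0) :
    y ∈ koszulCochains (gradedVector V K d) (LinearMap.ker π) D q :=
  fun τ => ⟨congrFun h τ, (hy τ).2⟩

theorem mapCochain_eq_zero_of_mem_ker {D q : ℤ} {y : Finset V → Fin r → MvPolynomial V K}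
    (hy : y ∈ koszulCochains (gradedVector V K d) (LinearMap.ker π) D q) : mapCochain π y = 0 :=
  funext fun τ => (hy τ).1

theorem koszulCochains_le_top {gM : ℤ → Submodule K M} {Z : Submodule (MvPolynomial V K) M}
    {D q : ℤ} : koszulCochains gM Z D q ≤ koszulCochains gM ⊤ D q :=
  fun _ hc τ => ⟨trivial, (hc τ).2⟩

variable [DecidableEq V] {ε : Finset V → V → K}

theorem mapCochain_koszulDifferential (y : Finset V → Fin r → MvPolynomial V K) :
    koszulDifferential ε (mapCochain π y) = mapCochain π (koszulDifferential ε y) :=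
  funext fun τ => coboundary_comp_linearMap (koszulWeight ε) π y τ

variable [Fintype V]

/-- Dimension shifting along a graded free module. -/
theorem koszulRank_ker (hε : IsAlternatingOn Finset.univ ε) (h0 : ∀ τ v, ε τ v ≠ 0)
    (hπ : ∀ m, ∀ f ∈ gradedVector V K d m, π f ∈ gM m)
    (hlift : ∀ m, ∀ z ∈ LinearMap.range π, z ∈ gM m → ∃ f ∈ gradedVector V K d m, π f = z)
    (hker : ∀ f ∈ LinearMap.ker π, ∀ a, constantCoeff (f a) = 0) (D : ℤ) {q : ℤ}
    (hq : q ≤ Fintype.card V) :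
    koszulRank ε (gradedVector V K d) (LinearMap.ker π) D q =
      koszulRank ε gM (LinearMap.range π) D (q - 1) := by
  have hXF : ∀ (v : V) m, ∀ x ∈ gradedVector V K d m,
    (X v : MvPolynomial V K) • x ∈ gradedVector V K d (m + 1) := X_smul_mem_gradedVector
  -- The common source consists of the free cochains `y` with `π (δ y) = 0`: `δ` sends it onto the
  -- cocycles of the kernel, and `π` onto the cocycles of the image. Surjectivity of the first map
  -- uses that elements of the kernel have no constant terms.
  refine finrank_quotient_eq_of_map
    (koszulCochains (gradedVector V K d) ⊤ D (q - 1) ⊓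
      LinearMap.ker (mapCochain π ∘ₗ koszulDifferential ε))
    (koszulDifferential ε) (mapCochain π) ?_ ?_ ?_
  · ext c
    constructor
    · rintro ⟨y, ⟨hy, hy0⟩, rfl⟩
      exact ⟨mem_ker_of_mapCochain_eq_zero (koszulDifferential_mem hXF ε hy) hy0,
        koszulDifferential_koszulDifferential hε y⟩
    · rintro ⟨hc, hc0⟩
      obtain ⟨y, hy, rfl⟩ := exists_koszulDifferential_eq hε h0 (koszulCochains_le_top hc) hc0
        fun a => hker _ (hc _).1 a
      exact ⟨y, ⟨hy, mapCochain_eq_zero_of_mem_ker hc⟩, rfl⟩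
  · ext z
    constructor
    · rintro ⟨y, ⟨hy, hy0⟩, rfl⟩
      exact ⟨mapCochain_mem hπ hy, (mapCochain_koszulDifferential y).trans hy0⟩
    · rintro ⟨hz, hz0⟩
      obtain ⟨y, hy, rfl⟩ := exists_mapCochain_eq hlift hz
      exact ⟨y, ⟨hy, (mapCochain_koszulDifferential y).symm.trans hz0⟩, rfl⟩
  · rintro y ⟨hy, -⟩
    constructor
    · rintro ⟨w, hw, hwy⟩
      have hyw : y - w ∈ koszulCochains (gradedVector V K d) ⊤ D (q - 1) :=
        Submodule.sub_mem _ hy (koszulCochains_le_top hw)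
      -- The condition on constant terms is automatic here: `q - 1 < |V|`, so the cochain is zero at
      -- `Finset.univ`.
      obtain ⟨u, hu, huy⟩ := exists_koszulDifferential_eq hε h0 hyw
        (by rw [map_sub, hwy, sub_self]) fun a => by
          rw [(hyw Finset.univ).2.2 (by rw [Finset.card_univ]; omega)]
          simp
      refine ⟨mapCochain π u, mapCochain_mem hπ hu, ?_⟩
      rw [mapCochain_koszulDifferential, huy, map_sub, mapCochain_eq_zero_of_mem_ker hw, sub_zero]
    · rintro ⟨z, hz, hzy⟩
      obtain ⟨u, hu, rfl⟩ := exists_mapCochain_eq hlift hz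
      refine ⟨y - koszulDifferential ε u, mem_ker_of_mapCochain_eq_zero
        (Submodule.sub_mem _ hy (koszulDifferential_mem hXF ε hu)) ?_, ?_⟩
      · rw [map_sub, ← mapCochain_koszulDifferential, hzy, sub_self]
      · rw [map_sub, koszulDifferential_koszulDifferential hε, sub_zero]

/-- The top Koszul cohomology counts the generators. -/
theorem koszulRank_range (hε : IsAlternatingOn Finset.univ ε) (h0 : ∀ τ v, ε τ v ≠ 0)
    (hπ : ∀ m, ∀ f ∈ gradedVector V K d m, π f ∈ gM m)
    (hlift : ∀ m, ∀ z ∈ LinearMap.range π, z ∈ gM m → ∃ f ∈ gradedVector V K d m, π f = z)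
    (hker : ∀ f ∈ LinearMap.ker π, ∀ a, constantCoeff (f a) = 0) (D : ℤ) :
    koszulRank ε gM (LinearMap.range π) D (Fintype.card V) =
      Fintype.card {a : Fin r // (d a : ℤ) = D + Fintype.card V} := by
  have hXF : ∀ (v : V) m, ∀ x ∈ gradedVector V K d m,
    (X v : MvPolynomial V K) • x ∈ gradedVector V K d (m + 1) := X_smul_mem_gradedVector
  have htop : ∀ y ∈ koszulCochains (gradedVector V K d) ⊤ D (Fintype.card V),
      koszulDifferential ε y = 0 := by
    refine fun y hy => funext fun τ => coboundary_eq_zero fun v hv => (hy _).2.2 ?_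
    have h1 := Finset.card_erase_add_one hv
    have h2 := Finset.card_le_univ τ
    omega
  -- At the top only `Finset.univ` matters, and coboundaries there have coefficients in the maximal
  -- ideal. What remains are the constant terms at the generators of degree `D + |V|`.
  let α : (Finset V → Fin r → MvPolynomial V K) →ₗ[K]
      ({a : Fin r // (d a : ℤ) = D + Fintype.card V} → K) :=
    { toFun := fun y a => constantCoeff (y Finset.univ a)
      map_add' := fun y z => by
        funext a
        simp
      map_smul' := fun c y => by
        funext a
        simp }
  have hα : ∀ y ∈ koszulCochains (gradedVector V K d) ⊤ D (Fintype.card V),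
      α y = 0 → ∀ a, constantCoeff (y Finset.univ a) = 0 := by
    intro y hy h a
    by_cases ha : (d a : ℤ) = D + Fintype.card V
    · exact congrFun h ⟨a, ha⟩
    · exact constantCoeff_eq_zero_of_mem_gradedPart (by omega)
        (mem_gradedVector.1 (hy Finset.univ).2.1 a)
  have hαd : ∀ u, α (koszulDifferential ε u) = 0 := by
    intro u
    funext a
    change constantCoeff (koszulDifferential ε u Finset.univ a) = 0
    rw [koszulDifferential_apply, coboundary_apply, Finset.sum_apply, map_sum]
    refine Finset.sum_eq_zero fun v _ => ?_
    simp [koszulWeight]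
  have hrank : koszulRank ε gM (LinearMap.range π) D (Fintype.card V) =
      Module.finrank K ((⊤ : Submodule K ({a : Fin r // (d a : ℤ) = D + Fintype.card V} → K)) ⧸
        (⊥ : Submodule K ({a : Fin r // (d a : ℤ) = D + Fintype.card V} → K)).submoduleOf ⊤) := by
    refine finrank_quotient_eq_of_map
      (koszulCochains (gradedVector V K d) ⊤ D (Fintype.card V)) (mapCochain π) α ?_ ?_ ?_
    · ext z
      constructor
      · rintro ⟨y, hy, rfl⟩
        refine ⟨mapCochain_mem hπ hy, ?_⟩
        change koszulDifferential ε (mapCochain π y) = 0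
        rw [mapCochain_koszulDifferential, htop y hy, map_zero]
      · rintro ⟨hz, -⟩
        exact exists_mapCochain_eq hlift hz
    · refine eq_top_iff.2 fun w _ => ?_
      refine ⟨fun τ a => if τ = Finset.univ then
        if h : (d a : ℤ) = D + Fintype.card V then C (w ⟨a, h⟩) else 0 else 0, fun τ =>
        ⟨trivial, mem_gradedVector.2 fun a => ?_, fun h => ?_⟩, ?_⟩
      · dsimp only
        split_ifs with h1 h2
        · intro e he
          rw [coeff_C] at he
          split_ifs at he with h3
          · rw [← h3, map_zero]
            push_cast
            omega
          · exact absurd rfl he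
        · exact Submodule.zero_mem _
        · exact Submodule.zero_mem _
      · funext a
        refine if_neg fun h' => h ?_
        rw [h', Finset.card_univ]
      · funext a
        change constantCoeff (if _ then _ else _) = _
        rw [if_pos rfl, dif_pos a.2, constantCoeff_C]
    · intro y hy
      rw [Submodule.mem_bot]
      constructor
      · rintro ⟨z, hz, hzy⟩
        obtain ⟨u, hu, rfl⟩ := exists_mapCochain_eq hlift hz
        have h1 : mapCochain π (y - koszulDifferential ε u) = 0 := by
          rw [map_sub, ← mapCochain_koszulDifferential, hzy, sub_self]
        have h2 : α (y - koszulDifferential ε u) = 0 :=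
          funext fun a => hker _ (congrFun h1 Finset.univ) a
        rwa [map_sub, hαd, sub_zero] at h2
      · intro h
        obtain ⟨u, hu, rfl⟩ := exists_koszulDifferential_eq hε h0 hy (htop y hy) (hα y hy h)
        exact ⟨mapCochain π u, mapCochain_mem hπ hu, mapCochain_koszulDifferential u⟩
  rw [hrank]
  have hbot : (⊥ : Submodule K ({a : Fin r // (d a : ℤ) = D + Fintype.card V} → K)).submoduleOf ⊤ =
      ⊥ := by
    rw [Submodule.submoduleOf, Submodule.comap_bot, Submodule.ker_subtype]
  rw [hbot, ((Submodule.quotEquivOfEqBot _ rfl).trans Submodule.topEquiv).finrank_eq,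
    Module.finrank_pi]

end Shift

/-! ### Homogeneous components and graded maps -/

section HomogeneousComponents

open MvPolynomial

variable {V : Type*} {K : Type*} [Field K] {r : ℕ}

variable (V K) in
/-- The projection of the polynomial ring to its homogeneous component of degree `m`. -/
noncomputable def gradedProj (m : ℤ) : MvPolynomial V K →ₗ[K] MvPolynomial V K :=
  if 0 ≤ m then homogeneousComponent m.toNat else 0

theorem coeff_gradedProj (m : ℤ) (f : MvPolynomial V K) (e : V →₀ ℕ) :
    coeff e (gradedProj V K m f) = if (e.degree : ℤ) = m then coeff e f else 0 := by
  rw [gradedProj]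
  by_cases hm : 0 ≤ m
  · rw [if_pos hm, coeff_homogeneousComponent]
    exact if_congr (by omega) rfl rfl
  · rw [if_neg hm, if_neg (by omega)]
    simp

theorem gradedProj_mem (m : ℤ) (f : MvPolynomial V K) : gradedProj V K m f ∈ gradedPart V K m := by
  intro e he
  rw [coeff_gradedProj] at he
  by_contra h
  exact he (if_neg h)

theorem gradedProj_of_mem {m : ℤ} {f : MvPolynomial V K} (hf : f ∈ gradedPart V K m) (k : ℤ) :
    gradedProj V K k f = if m = k then f else 0 := by
  ext e
  rw [coeff_gradedProj]
  by_cases he : coeff e f = 0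
  · split_ifs <;> simp [he]
  · rw [hf e he]
    split_ifs <;> simp

variable (V K) in
/-- The projection of a graded free module to its homogeneous component of degree `m`. -/
noncomputable def gradedVectorProj (d : Fin r → ℕ) (m : ℤ) :
    (Fin r → MvPolynomial V K) →ₗ[K] (Fin r → MvPolynomial V K) :=
  LinearMap.pi fun a => gradedProj V K (m - d a) ∘ₗ LinearMap.proj a

theorem gradedVectorProj_apply (d : Fin r → ℕ) (m : ℤ) (f : Fin r → MvPolynomial V K) (a : Fin r) :
    gradedVectorProj V K d m f a = gradedProj V K (m - d a) (f a) := rfl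

theorem gradedVectorProj_mem (d : Fin r → ℕ) (m : ℤ) (f : Fin r → MvPolynomial V K) :
    gradedVectorProj V K d m f ∈ gradedVector V K d m :=
  mem_gradedVector.2 fun _ => gradedProj_mem _ _

theorem gradedVectorProj_of_mem {d : Fin r → ℕ} {m : ℤ} {f : Fin r → MvPolynomial V K}
    (hf : f ∈ gradedVector V K d m) (k : ℤ) :
    gradedVectorProj V K d k f = if m = k then f else 0 := by
  funext a
  rw [gradedVectorProj_apply, gradedProj_of_mem (mem_gradedVector.1 hf a)]
  by_cases h : m = k
  · rw [if_pos h, if_pos (by rw [h])]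
  · rw [if_neg h, if_neg (fun h' => h (by omega))]
    rfl

theorem exists_sum_gradedVectorProj_eq (d : Fin r → ℕ) (f : Fin r → MvPolynomial V K) :
    ∃ N : ℕ, ∑ m ∈ Finset.range N, gradedVectorProj V K d m f = f := by
  refine ⟨∑ a, ((f a).totalDegree + d a) + 1, ?_⟩
  funext a
  ext e
  rw [Finset.sum_apply, coeff_sum]
  simp only [gradedVectorProj_apply, coeff_gradedProj]
  by_cases he : coeff e (f a) = 0
  · simp [he]
  · have h1 : e.degree ≤ (f a).totalDegree := le_totalDegree (mem_support_iff.2 he)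
    have h2 : (f a).totalDegree + d a ≤ ∑ a, ((f a).totalDegree + d a) :=
      Finset.single_le_sum (f := fun a => (f a).totalDegree + d a) (fun _ _ => Nat.zero_le _)
        (Finset.mem_univ a)
    rw [Finset.sum_eq_single_of_mem (e.degree + d a) (Finset.mem_range.2 (by omega))]
    · rw [if_pos]
      push_cast
      ring
    · intro m _ hm
      exact if_neg fun h => hm (by omega)

section GradedMaps

variable {M : Type*} [AddCommGroup M] [Module (MvPolynomial V K) M]
  [Module K M] {gM : ℤ → Submodule K M} {P : ℤ → M →ₗ[K] M} {d : Fin r → ℕ} {π : (Fin r → MvPolynomial V K) →ₗ[MvPolynomial V K] M}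

/-- Graded maps commute with the projections to the homogeneous components. -/
theorem map_gradedVectorProj (hP : ∀ m, ∀ z ∈ gM m, ∀ k, P k z = if m = k then z else 0)
    (hπ : ∀ m, ∀ f ∈ gradedVector V K d m, π f ∈ gM m) (k : ℤ) (f : Fin r → MvPolynomial V K) :
    π (gradedVectorProj V K d k f) = P k (π f) := by
  obtain ⟨N, hN⟩ := exists_sum_gradedVectorProj_eq d f
  conv_lhs => rw [← hN]
  conv_rhs => rw [← hN]
  simp only [map_sum]
  refine Finset.sum_congr rfl fun m _ => ?_
  rw [hP _ _ (hπ _ _ (gradedVectorProj_mem d _ f)),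
    gradedVectorProj_of_mem (gradedVectorProj_mem d _ f)]
  split_ifs <;> simp

/-- Homogeneous elements of the image of a graded map lift to homogeneous elements. -/
theorem exists_mem_gradedVector_map_eq
    (hP : ∀ m, ∀ z ∈ gM m, ∀ k, P k z = if m = k then z else 0)
    (hπ : ∀ m, ∀ f ∈ gradedVector V K d m, π f ∈ gM m) (k : ℤ) {z : M}
    (hz : z ∈ LinearMap.range π) (hzk : z ∈ gM k) :
    ∃ f ∈ gradedVector V K d k, π f = z := by
  obtain ⟨f, rfl⟩ := hz
  refine ⟨_, gradedVectorProj_mem d k f, ?_⟩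
  rw [map_gradedVectorProj hP hπ, hP k _ hzk, if_pos rfl]

end GradedMaps

theorem isHomogeneous_iff {f : MvPolynomial V K} {m : ℕ} :
    f.IsHomogeneous m ↔ f ∈ gradedPart V K m := by
  rw [mem_gradedPart]
  simp only [Nat.cast_inj, Finsupp.degree_eq_weight_one]
  exact Iff.rfl

theorem isHomogeneousVector_iff {d : Fin r → ℕ} {f : Fin r → MvPolynomial V K} {m : ℕ} :
    IsHomogeneousVector d f m ↔ f ∈ gradedVector V K d m := by
  rw [mem_gradedVector, IsHomogeneousVector]
  refine forall_congr' fun a => ?_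
  rw [isHomogeneous_iff]
  constructor
  · rintro (⟨hle, h⟩ | h)
    · rwa [Nat.cast_sub hle] at h
    · rw [h]
      exact Submodule.zero_mem _
  · intro h
    by_cases h0 : f a = 0
    · exact Or.inr h0
    · obtain ⟨e, he⟩ := ne_zero_iff.1 h0
      have hle : d a ≤ m := by
        have := h e he
        omega
      rw [Nat.cast_sub hle]
      exact Or.inl ⟨hle, h⟩

theorem eq_zero_of_mem_gradedVector_of_neg {d : Fin r → ℕ} {m : ℤ} (hm : m < 0)
    {f : Fin r → MvPolynomial V K} (hf : f ∈ gradedVector V K d m) : f = 0 := by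
  funext a
  by_contra h0
  obtain ⟨e, he⟩ := ne_zero_iff.1 h0
  have := mem_gradedVector.1 hf a e he
  omega

theorem constantCoeff_eq_zero_of_mem_span {p : MvPolynomial V K}
    (hp : p ∈ Ideal.span (Set.range (X (R := K) (σ := V)))) : constantCoeff p = 0 := by
  have : Ideal.span (Set.range (X (R := K) (σ := V))) ≤ RingHom.ker constantCoeff := by
    rw [Ideal.span_le]
    rintro _ ⟨v, rfl⟩
    exact constantCoeff_X K v
  exact this hp

end HomogeneousComponents

/-! ### Betti numbers as Koszul cohomology -/

namespace MinimalGradedFreeResolution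

open MvPolynomial

variable {V : Type*} {K : Type*} [Field K] {I : Ideal (MvPolynomial V K)}
  (F : MinimalGradedFreeResolution I)

theorem aug_mem_gradedPart (m : ℤ) (f) (hf : f ∈ gradedVector V K (F.deg 0) m) :
    F.aug f ∈ gradedPart V K m := by
  rcases lt_or_ge m 0 with hm | hm
  · rw [eq_zero_of_mem_gradedVector_of_neg hm hf, map_zero]
    exact Submodule.zero_mem _
  · lift m to ℕ using hm
    exact isHomogeneous_iff.1 (F.aug_homogeneous f m (isHomogeneousVector_iff.2 hf))

theorem d_mem_gradedVector (i : ℕ) (m : ℤ) (f) (hf : f ∈ gradedVector V K (F.deg (i + 1)) m) :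
    F.d i f ∈ gradedVector V K (F.deg i) m := by
  rcases lt_or_ge m 0 with hm | hm
  · rw [eq_zero_of_mem_gradedVector_of_neg hm hf, map_zero]
    exact Submodule.zero_mem _
  · lift m to ℕ using hm
    exact isHomogeneousVector_iff.1 (F.d_homogeneous i f m (isHomogeneousVector_iff.2 hf))

theorem constantCoeff_eq_zero_of_mem_range (i : ℕ) (f) (hf : f ∈ LinearMap.range (F.d i)) (a) :
    constantCoeff (f a) = 0 := by
  obtain ⟨g, rfl⟩ := hf
  exact constantCoeff_eq_zero_of_mem_span (F.minimal i g a)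

theorem ker_aug : LinearMap.ker F.aug = LinearMap.range (F.d 0) :=
  F.exact_zero.linearMap_ker_eq

theorem ker_d (i : ℕ) : LinearMap.ker (F.d i) = LinearMap.range (F.d (i + 1)) :=
  (F.exact_succ i).linearMap_ker_eq

theorem aug_lift (m : ℤ) (z) (hz : z ∈ LinearMap.range F.aug) (hzm : z ∈ gradedPart V K m) :
    ∃ f ∈ gradedVector V K (F.deg 0) m, F.aug f = z :=
  exists_mem_gradedVector_map_eq (fun _ _ hz k => gradedProj_of_mem hz k) F.aug_mem_gradedPart m
    hz hzm

theorem d_lift (i : ℕ) (m : ℤ) (z) (hz : z ∈ LinearMap.range (F.d i))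
    (hzm : z ∈ gradedVector V K (F.deg i) m) :
    ∃ f ∈ gradedVector V K (F.deg (i + 1)) m, F.d i f = z :=
  exists_mem_gradedVector_map_eq (fun _ _ hz k => gradedVectorProj_of_mem hz k)
    (F.d_mem_gradedVector i) m hz hzm

variable [Fintype V]

/-- The degree is written as `D + |V|` with `D = J - |V|` to match `koszulRank_range`. -/
theorem betti_eq_card (i J : ℕ) : F.betti i J =
    Fintype.card {a : Fin (F.rank i) // (F.deg i a : ℤ) =
      (J - Fintype.card V : ℤ) + Fintype.card V} := by
  rw [Fintype.card_subtype, betti]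
  congr 1
  ext a
  simp

variable [DecidableEq V] {ε : Finset V → V → K}

/-- By exactness each image is the kernel of the preceding map, so `i + 1` dimension shifts lead
down to the ideal itself. -/
theorem koszulRank_range_d (hε : IsAlternatingOn Finset.univ ε) (h0 : ∀ τ v, ε τ v ≠ 0) (D : ℤ)
    (i : ℕ) {q : ℤ} (hq : q ≤ Fintype.card V) :
    koszulRank ε (gradedVector V K (F.deg i)) (LinearMap.range (F.d i)) D q =
      koszulRank ε (gradedPart V K) I D (q - (i + 1)) := by
  induction i generalizing q with
  | zero =>
    rw [← F.ker_aug, koszulRank_ker hε h0 F.aug_mem_gradedPart F.aug_lift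
      (fun f hf => F.constantCoeff_eq_zero_of_mem_range 0 f (F.ker_aug ▸ hf)) D hq, F.range_aug]
    simp
  | succ i ih =>
    rw [← F.ker_d, koszulRank_ker hε h0 (F.d_mem_gradedVector i) (F.d_lift i)
      (fun f hf => F.constantCoeff_eq_zero_of_mem_range (i + 1) f (F.ker_d i ▸ hf)) D hq,
      ih (by omega)]
    congr 1
    push_cast
    ring

/-- The graded Betti numbers are the dimensions of the Koszul cohomology of the ideal. -/
theorem betti_eq_koszulRank (hε : IsAlternatingOn Finset.univ ε) (h0 : ∀ τ v, ε τ v ≠ 0)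
    (i J : ℕ) : F.betti i J =
      koszulRank ε (gradedPart V K) I (J - Fintype.card V) (Fintype.card V - i) := by
  rw [betti_eq_card]
  cases i with
  | zero =>
    rw [← koszulRank_range hε h0 F.aug_mem_gradedPart F.aug_lift
      (fun f hf => F.constantCoeff_eq_zero_of_mem_range 0 f (F.ker_aug ▸ hf)), F.range_aug]
    simp
  | succ i =>
    rw [← koszulRank_range hε h0 (F.d_mem_gradedVector i) (F.d_lift i)
      (fun f hf => F.constantCoeff_eq_zero_of_mem_range (i + 1) f (F.ker_d i ▸ hf)),
      F.koszulRank_range_d hε h0 _ i le_rfl]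
    push_cast
    rfl

/-- A graded Betti number of an edge ideal vanishes if the cohomology of the independence
complexes of the induced subgraphs of the corresponding size does. -/
theorem betti_edgeIdeal_eq_zero {G : SimpleGraph V}
    (F : MinimalGradedFreeResolution (edgeIdeal K G)) {i J : ℕ}
    (h : ∀ W : Finset V, W.card = J → IndepAcyclic K G W (J - i - 1)) : F.betti i J = 0 := by
  obtain ⟨ε, hε, h0⟩ := exists_isAlternatingOn_univ V K
  rw [F.betti_eq_koszulRank hε h0]
  refine koszulRank_edgeIdeal_eq_zero hε h0 fun W hW => ?_
  have := h W (by omega)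
  rwa [show (J - Fintype.card V : ℤ) + (Fintype.card V - i) - 1 = J - i - 1 by ring]

theorem betti_edgeIdeal_eq_one [Nonempty V] {G : SimpleGraph V}
    (F : MinimalGradedFreeResolution (edgeIdeal K G)) {i : ℕ}
    (h : IndepLine K G (Finset.univ : Finset V) (Fintype.card V - i - 1)) :
    F.betti i (Fintype.card V) = 1 := by
  obtain ⟨ε, hε, h0⟩ := exists_isAlternatingOn_univ V K
  rw [F.betti_eq_koszulRank hε h0, sub_self]
  exact koszulRank_edgeIdeal_eq_one hε h0 h

end MinimalGradedFreeResolution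

/-! ### Existence of minimal graded free resolutions -/

section Existence

open MvPolynomial

variable {V : Type*} {K : Type*} [Field K] {r : ℕ}

theorem mul_mem_gradedPart {m n : ℤ} {f g : MvPolynomial V K} (hf : f ∈ gradedPart V K m)
    (hg : g ∈ gradedPart V K n) : f * g ∈ gradedPart V K (m + n) := by
  classical
  intro e he
  rw [coeff_mul] at he
  obtain ⟨⟨x, y⟩, hxy, hne⟩ := Finset.exists_ne_zero_of_sum_ne_zero he
  rw [← Finset.HasAntidiagonal.mem_antidiagonal.1 hxy, map_add, Nat.cast_add, hf x (left_ne_zero_of_mul hne),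
    hg y (right_ne_zero_of_mul hne)]

theorem smul_mem_gradedVector {d : Fin r → ℕ} {m n : ℤ} {f : MvPolynomial V K}
    {g : Fin r → MvPolynomial V K} (hf : f ∈ gradedPart V K m) (hg : g ∈ gradedVector V K d n) :
    f • g ∈ gradedVector V K d (m + n) := by
  rw [mem_gradedVector] at hg ⊢
  intro a
  rw [add_sub_assoc]
  exact mul_mem_gradedPart hf (hg a)

theorem mem_span_range_X_iff {p : MvPolynomial V K} :
    p ∈ Ideal.span (Set.range (X (R := K) (σ := V))) ↔ constantCoeff p = 0 := by
  refine ⟨constantCoeff_eq_zero_of_mem_span, fun h => ?_⟩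
  rw [← Set.image_univ, mem_ideal_span_X_image]
  intro e he
  by_contra! hcon
  have : e = 0 := by
    ext v
    exact hcon v (Set.mem_univ v)
  rw [this, mem_support_iff] at he
  exact he h

theorem eq_C_of_mem_gradedPart_zero {f : MvPolynomial V K} (hf : f ∈ gradedPart V K 0) :
    f = C (constantCoeff f) := by
  classical
  ext e
  rw [coeff_C]
  split_ifs with h
  · rw [← h]
    rfl
  · by_contra hne
    refine h (Eq.symm ?_)
    have := hf e hne
    rwa [Nat.cast_eq_zero, Finsupp.degree_eq_zero_iff] at this

/-- `Z` has a family of `s` homogeneous generators. -/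
def HasHomogeneousGenerators (d : Fin r → ℕ)
    (Z : Submodule (MvPolynomial V K) (Fin r → MvPolynomial V K)) (s : ℕ) : Prop :=
  ∃ (d' : Fin s → ℕ) (g : Fin s → Fin r → MvPolynomial V K),
    (∀ a, g a ∈ gradedVector V K d (d' a)) ∧ Submodule.span _ (Set.range g) = Z

/-- Split a finite generating set into homogeneous components. They are stored together with their
degrees, since a zero component does not determine its own. -/
theorem exists_hasHomogeneousGenerators [Finite V] {d : Fin r → ℕ}
    {Z : Submodule (MvPolynomial V K) (Fin r → MvPolynomial V K)}
    (hZ : ∀ f ∈ Z, ∀ m, gradedVectorProj V K d m f ∈ Z) :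
    ∃ s, HasHomogeneousGenerators d Z s := by
  classical
  obtain ⟨S, hS⟩ := IsNoetherian.noetherian Z
  choose N hN using fun f => exists_sum_gradedVectorProj_eq (K := K) (V := V) d f
  let T : Finset (ℕ × (Fin r → MvPolynomial V K)) := S.biUnion fun f =>
    (Finset.range (N f)).image fun m : ℕ => (m, gradedVectorProj V K d m f)
  have hT : ∀ x ∈ T, ∃ f ∈ S, x.2 = gradedVectorProj V K d x.1 f := by
    intro x hx
    obtain ⟨f, hf, hx⟩ := Finset.mem_biUnion.1 hx
    obtain ⟨m, -, rfl⟩ := Finset.mem_image.1 hx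
    exact ⟨f, hf, rfl⟩
  refine ⟨T.card, fun a => (T.equivFin.symm a).1.1, fun a => (T.equivFin.symm a).1.2, fun a => ?_,
    le_antisymm (Submodule.span_le.2 ?_) ?_⟩
  · obtain ⟨f, -, h⟩ := hT _ (T.equivFin.symm a).2
    dsimp only
    rw [h]
    exact gradedVectorProj_mem _ _ _
  · rintro _ ⟨a, rfl⟩
    obtain ⟨f, hf, h⟩ := hT _ (T.equivFin.symm a).2
    dsimp only
    rw [h]
    refine hZ f ?_ _
    rw [← hS]
    exact Submodule.subset_span hf
  · rw [← hS, Submodule.span_le]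
    intro f hf
    rw [SetLike.mem_coe, ← hN f]
    refine Submodule.sum_mem _ fun m hm => Submodule.subset_span ?_
    have hmem : ((m, gradedVectorProj V K d m f) : ℕ × (Fin r → MvPolynomial V K)) ∈ T :=
      Finset.mem_biUnion.2 ⟨f, hf, Finset.mem_image.2 ⟨m, hm, rfl⟩⟩
    exact ⟨T.equivFin ⟨_, hmem⟩, by simp⟩

/-- A graded submodule of a graded free module has a minimal graded cover. -/
theorem exists_minimal_cover [Finite V] {d : Fin r → ℕ}
    {Z : Submodule (MvPolynomial V K) (Fin r → MvPolynomial V K)}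
    (hZ : ∀ f ∈ Z, ∀ m, gradedVectorProj V K d m f ∈ Z) :
    ∃ (s : ℕ) (d' : Fin s → ℕ)
      (φ : (Fin s → MvPolynomial V K) →ₗ[MvPolynomial V K] (Fin r → MvPolynomial V K)),
      LinearMap.range φ = Z ∧ (∀ m, ∀ f ∈ gradedVector V K d' m, φ f ∈ gradedVector V K d m) ∧
      ∀ f ∈ LinearMap.ker φ, ∀ a, constantCoeff (f a) = 0 := by
  classical
  have hex := exists_hasHomogeneousGenerators hZ
  -- Minimality of the cover comes from taking the least number of homogeneous generators.
  obtain ⟨s, hs, hmin⟩ : ∃ s, HasHomogeneousGenerators d Z s ∧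
      ∀ s' < s, ¬ HasHomogeneousGenerators d Z s' :=
    ⟨Nat.find hex, Nat.find_spec hex, fun _ h => Nat.find_min hex h⟩
  obtain ⟨d', g, hg, hspan⟩ := hs
  have hφ : ∀ m, ∀ f ∈ gradedVector V K d' m,
      Fintype.linearCombination (MvPolynomial V K) g f ∈ gradedVector V K d m := by
    intro m f hf
    rw [Fintype.linearCombination_apply]
    refine Submodule.sum_mem _ fun a _ => ?_
    have := smul_mem_gradedVector (mem_gradedVector.1 hf a) (hg a)
    rwa [sub_add_cancel] at this
  refine ⟨s, d', Fintype.linearCombination (MvPolynomial V K) g, ?_, hφ, fun f hf a => ?_⟩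
  · rw [Fintype.range_linearCombination, hspan]
  by_contra hne
  obtain ⟨s, rfl⟩ : ∃ s', s = s' + 1 := ⟨s - 1, by have := a.2; omega⟩
  refine hmin s (Nat.lt_succ_self s) ⟨fun b => d' (a.succAbove b), fun b => g (a.succAbove b),
    fun b => hg _, ?_⟩
  -- If a relation has a nonzero constant term at `a`, its component of degree `d' a` is still a
  -- relation and has a unit as coefficient of `g a`. So `g a` is redundant, against the choice of
  -- `s`.
  have hf' : Fintype.linearCombination (MvPolynomial V K) g (gradedVectorProj V K d' (d' a) f) = 0 := by
    rw [map_gradedVectorProj (fun _ _ hz k => gradedVectorProj_of_mem hz k) hφ,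
      LinearMap.mem_ker.1 hf, map_zero]
  have hfa : gradedVectorProj V K d' (d' a) f a = C (constantCoeff (f a)) := by
    rw [gradedVectorProj_apply, sub_self, eq_C_of_mem_gradedPart_zero (gradedProj_mem _ _)]
    congr 1
    exact (coeff_gradedProj 0 (f a) 0).trans (if_pos (by simp))
  rw [Fintype.linearCombination_apply, Fin.sum_univ_succAbove _ a, hfa] at hf'
  have hga : g a ∈ Submodule.span (MvPolynomial V K)
      (Set.range fun b => g (a.succAbove b)) := by
    have h1 : g a = (C (constantCoeff (f a))⁻¹ : MvPolynomial V K) •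
        ((C (constantCoeff (f a)) : MvPolynomial V K) • g a) := by
      rw [smul_smul, ← C_mul, inv_mul_cancel₀ hne, C_1, one_smul]
    rw [h1, eq_neg_of_add_eq_zero_left hf']
    refine Submodule.smul_mem _ _ (Submodule.neg_mem _ (Submodule.sum_mem _ fun b _ => ?_))
    exact Submodule.smul_mem _ _ (Submodule.subset_span ⟨b, rfl⟩)
  rw [← hspan]
  refine le_antisymm (Submodule.span_mono ?_) (Submodule.span_le.2 ?_)
  · rintro _ ⟨b, rfl⟩
    exact ⟨_, rfl⟩
  · rintro _ ⟨b, rfl⟩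
    rcases eq_or_ne b a with rfl | hba
    · exact hga
    · obtain ⟨c, rfl⟩ := Fin.exists_succAbove_eq hba
      exact Submodule.subset_span ⟨c, rfl⟩

variable (V K) in
/-- A graded submodule of a graded free module. -/
structure GradedSubmodule where
  rank : ℕ
  deg : Fin rank → ℕ
  module : Submodule (MvPolynomial V K) (Fin rank → MvPolynomial V K)
  proj_mem : ∀ f ∈ module, ∀ m, gradedVectorProj V K deg m f ∈ module

/-- `T` is the syzygy module of a minimal cover of `Z`. Minimality is recorded on the elements of
`T`, because `T` is the image of the next differential. -/
theorem GradedSubmodule.exists_next [Finite V] (Z : GradedSubmodule V K) :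
    ∃ (T : GradedSubmodule V K)
      (φ : (Fin T.rank → MvPolynomial V K) →ₗ[MvPolynomial V K] (Fin Z.rank → MvPolynomial V K)),
      LinearMap.range φ = Z.module ∧ LinearMap.ker φ = T.module ∧
      (∀ m, ∀ f ∈ gradedVector V K T.deg m, φ f ∈ gradedVector V K Z.deg m) ∧
      ∀ f ∈ T.module, ∀ a, f a ∈ Ideal.span (Set.range (X (R := K) (σ := V))) := by
  obtain ⟨s, d', φ, h1, h2, h3⟩ := exists_minimal_cover Z.proj_mem
  refine ⟨⟨s, d', LinearMap.ker φ, fun f hf m => ?_⟩, φ, h1, rfl, h2, fun f hf a =>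
    mem_span_range_X_iff.2 (h3 f hf a)⟩
  rw [LinearMap.mem_ker, map_gradedVectorProj (fun _ _ hz k => gradedVectorProj_of_mem hz k) h2,
    LinearMap.mem_ker.1 hf, map_zero]

/-- Homogeneous ideals have minimal graded free resolutions. -/
theorem nonempty_minimalGradedFreeResolution [Finite V] {I : Ideal (MvPolynomial V K)}
    (hI : ∀ f ∈ I, ∀ m, gradedProj V K m f ∈ I) : Nonempty (MinimalGradedFreeResolution I) := by
  choose next φ hrange hker hgr hmin using GradedSubmodule.exists_next (V := V) (K := K)
  -- The ideal is viewed as a graded submodule of the free module of rank 1 generated in degree 0,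
  -- so that the augmentation is obtained in the same way as the differentials.
  let S₀ : GradedSubmodule V K :=
    { rank := 1
      deg := fun _ => 0
      module := Submodule.comap (LinearMap.proj 0) I
      proj_mem := fun f hf m => hI _ hf _ }
  let S : ℕ → GradedSubmodule V K := fun i => Nat.rec S₀ (fun _ => next) i
  have hinj : ∀ f : Fin 1 → MvPolynomial V K, f 0 = 0 → f = 0 := by
    intro f hf
    funext a
    rw [Subsingleton.elim a 0, hf]
    rfl
  refine ⟨{
    rank := fun i => (S (i + 1)).rank
    deg := fun i => (S (i + 1)).deg
    aug := LinearMap.proj 0 ∘ₗ φ S₀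
    d := fun i => φ (S (i + 1))
    aug_homogeneous := ?_
    d_homogeneous := ?_
    range_aug := ?_
    exact_zero := ?_
    exact_succ := ?_
    minimal := ?_ }⟩
  · intro f m hf
    have := mem_gradedVector.1 (hgr S₀ m f (isHomogeneousVector_iff.1 hf)) 0
    rw [isHomogeneous_iff]
    simpa [S₀] using this
  · intro i f m hf
    exact isHomogeneousVector_iff.2 (hgr (S (i + 1)) m f (isHomogeneousVector_iff.1 hf))
  · rw [LinearMap.range_comp, hrange]
    exact Submodule.map_comap_eq_of_surjective
      (f := (LinearMap.proj 0 : (Fin 1 → MvPolynomial V K) →ₗ[MvPolynomial V K] MvPolynomial V K))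
      (LinearMap.proj_surjective 0) I
  · rw [LinearMap.exact_iff]
    refine Eq.trans ?_ ((hker S₀).trans (hrange (S 1)).symm)
    ext f
    exact ⟨fun h => hinj _ h, fun h => congrFun h 0⟩
  · intro i
    rw [LinearMap.exact_iff]
    exact (hker (S (i + 1))).trans (hrange (S (i + 2))).symm
  · intro i f a
    exact hmin (S i) _ (hrange (S (i + 1)) ▸ LinearMap.mem_range_self _ f) a

theorem gradedProj_mem_edgeIdeal {G : SimpleGraph V} {f : MvPolynomial V K}
    (hf : f ∈ edgeIdeal K G) (m : ℤ) : gradedProj V K m f ∈ edgeIdeal K G := by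
  rw [mem_edgeIdeal_iff] at hf ⊢
  intro e he
  rw [coeff_gradedProj] at he
  split_ifs at he
  · exact hf e he
  · exact absurd rfl he

end Existence

/-! ### The main theorem -/

theorem mainTheorem1 (K : Type*) [Field K] (t k n : ℕ) (ht : 1 ≤ t) (hk : 3 ≤ k)
    (hn : n = t * (k - 1) + 2) :
    Nonempty (MinimalGradedFreeResolution (edgeIdeal K (generalizedAndrasfai' t k))) ∧
    ∀ F : MinimalGradedFreeResolution (edgeIdeal K (generalizedAndrasfai' t k)),
      (∀ i j : ℕ, t + 2 ≤ j →
        F.betti i (i + j) = if i + j = n ∧ j = t + 2 then 1 else 0) ∧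
      F.HasRegularity (t + 2) ∧
      ∃ p : ℕ, F.HasLength p ∧
        ∀ i : ℕ, F.betti i (i + (t + 2)) = if i = p then 1 else 0 := by
  refine ⟨nonempty_minimalGradedFreeResolution fun f hf m => gradedProj_mem_edgeIdeal hf m,
    fun F => ?_⟩
  have hlab := isAndrasfaiLabelling_val_sub (k := k) ht hk
  have huniv := (hlab 0).indepLine_univ (K := K) ht hk
  have hcard : Fintype.card (ZMod (t * (k - 1) + 2)) = n := by rw [ZMod.card, hn]
  have hn2 : 2 * t + 2 ≤ n := by
    have := Nat.mul_le_mul_left t (show 2 ≤ k - 1 by omega)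
    omega
  -- Beyond homological degree `n - t - 2` all Betti numbers vanish, whatever the internal degree
  -- `J`. For proper `W` the relevant face size plus `|Wᶜ|` is `n - i - 1 ≤ t`.
  have hlarge : ∀ i J, n < i + t + 2 → F.betti i J = 0 := by
    refine fun i J hi => F.betti_edgeIdeal_eq_zero fun W hW => ?_
    by_cases huW : W = Finset.univ
    · subst huW
      rw [Finset.card_univ, hcard] at hW
      exact huniv.2 _ (by omega)
    · obtain ⟨c, hc⟩ : ∃ c, c ∉ W := by
        by_contra! h
        exact huW (Finset.eq_univ_of_forall h)
      refine (hlab c).indepAcyclic_of_le hk (c := c) (by simp) hc ?_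
      have h1 := Finset.card_le_univ W
      rw [Finset.card_compl, hcard]
      omega
  have hmain : ∀ i j : ℕ, t + 2 ≤ j →
      F.betti i (i + j) = if i + j = n ∧ j = t + 2 then 1 else 0 := by
    intro i j hj
    split_ifs with h
    · rw [h.1, ← hcard]
      refine F.betti_edgeIdeal_eq_one ?_
      -- Here `i + j = n` and `j = t + 2`, so the face size `j - 1` is that of the sphere class.
      rw [hcard, show (n - i - 1 : ℤ) = t + 1 by omega]
      exact huniv.1
    · refine F.betti_edgeIdeal_eq_zero fun W hW => ?_
      by_cases huW : W = Finset.univ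
      · subst huW
        rw [Finset.card_univ, hcard] at hW
        exact huniv.2 _ (by omega)
      · obtain ⟨c, hc⟩ : ∃ c, c ∉ W := by
          by_contra! h
          exact huW (Finset.eq_univ_of_forall h)
        -- The labelling is cut at a vertex `c` missing from `W`, so all positions are at least 1,
        -- and the face size is `j - 1 ≥ t + 1`.
        refine (hlab c).indepAcyclic_of_lt ht hk (fun v hv => ?_) (by push_cast; omega)
        rw [Nat.one_le_iff_ne_zero, ne_eq, ZMod.val_eq_zero, sub_eq_zero]
        rintro rfl
        exact hc hv
  have hp : F.betti (n - t - 2) (n - t - 2 + (t + 2)) = 1 := by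
    rw [hmain _ _ le_rfl, if_pos ⟨by omega, rfl⟩]
  refine ⟨hmain, ⟨⟨n - t - 2, by rw [hp]; exact one_ne_zero⟩, ?_⟩, n - t - 2, ⟨?_, ?_⟩, ?_⟩
  · rintro j ⟨i, hi⟩
    by_contra hlt
    exact hi ((hmain i j (by omega)).trans (if_neg (by omega)))
  · intro h0
    have : F.betti (n - t - 2) (n - t - 2 + (t + 2)) ≤ F.rank (n - t - 2) :=
      (Finset.card_filter_le _ _).trans_eq (Finset.card_fin _)
    omega
  · intro i hi
    by_contra hlt
    -- A nonzero free module beyond step `n - t - 2` would have a generator in some degree, and the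
    -- Betti number in that degree would be nonzero.
    have hz := hlarge i (F.deg i ⟨0, Nat.pos_of_ne_zero hi⟩) (by omega)
    rw [MinimalGradedFreeResolution.betti, Finset.card_eq_zero, Finset.filter_eq_empty_iff] at hz
    exact hz (Finset.mem_univ _) rfl
  · intro i
    rw [hmain i _ le_rfl]
    exact if_congr (by omega) rfl rfl
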